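/- **Model.** Two agents $A,B$ are points in the plane. An instance is a tuple $(r,x,y,\phi,\tau,v,t,\chi)$ of reals with $r>0$, $0\le\phi<2\pi$, $\tau>0$, $v>0$, $t\ge 0$, $\chi\in\{1,-1\}$. In the coordinate system and units of $A$: agent $A$ starts at $(0,0)$, wakes up at time $0$, has time unit $1$ and speed $1$; agent $B$ starts at $(x,y)$, wakes up at time $t$ (and is idle before), has time unit $\tau$ and speed $v$, hence length unit $\tau v$; the private coordinate system of $B$ has its origin at $(x,y)$, its $x$-axis is that of $A$ rotated counterclockwise by $\phi$, and its $y$-axis agrees with the rotated $y$-axis of $A$ if $\chi=1$ and is opposite to it if $\chi=-1$. The instance is *synchronous* if $\tau=v=1$. The *canonical line* is the line through the midpoint of the two initial positions that is parallel to the bisectrix of the angle between the two $x$-axes (to the $x$-axes if $\phi=0$), i.e. that has direction angle $\phi/2$; $proj_A$ and $proj_B$ are the orthogonal projections of the initial positions of $A$ and $B$ on it; $dist$ is the Euclidean distance. A *program* is an infinite sequence of instructions, of infinite total duration, of the forms $go(dir,d)$ (go straight by $d\ge0$ private length units in direction $dir$ of the private system; this lasts $d$ private time units) and $wait(z)$ (stay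 idle for $z\ge0$ private time units). Both agents execute the same program from their wake-up and both are interrupted forever as soon as they are at distance at most $r$ of each other. The program *guarantees rendezvous* for an instance if, from some time on, the agents are at distance at most $r$ and never move. $N,S,E,W$ denote the directions of the positive and negative $y$-axis and of the positive and negative $x$-axis. Say that a program is a *CGKK procedure* if it guarantees rendezvous for all instances with $t=0$ that are non-synchronous or satisfy $\phi\ne0$ and $\chi=1$; and a *Latecomers procedure* if it guarantees rendezvous for all synchronous instances with $\phi=0$, $\chi=1$ and $t>dist((0,0),(x,y))-r$. **Algorithms.** $\mathtt{LinearCowWalk}(i)$: for $j=1,\dots,i$: $go(E,2^j)$; $go(W,2^{j+1})$; $go(E,2^j)$. $\mathtt{PlanarCowWalk}(i)$: execute $\mathtt{LinearCowWalk}(i)$; then $2^{2i}$ times: $go(N,2^{-i})$, $\mathtt{LinearCowWalk}(i)$; then $go(S,2^i)$; then $2^{2i}$ times: $go(S,2^{-i})$, $\mathtt{LinearCowWalk}(i)$; then $go(N,2^i)$. $\mathtt{AlmostUniversalRV}$, built from a CGKK procedure $\mathtt{CGKK}$ and a Latecomers procedure $\mathtt{Latecomers}$: for $i=1,2,3,\dots$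 (until the other agent is seen): 1. for $j=1,\dots,2^{i+1}$: execute $\mathtt{PlanarCowWalk}(i)$ in the private system rotated counterclockwise (with respect to this system) by $j\pi/2^i$; 2. $wait(2^i)$; execute $\mathtt{Latecomers}$ during time $2^i$; backtrack along the path followed in this execution of $\mathtt{Latecomers}$; 3. $wait(2^{15i^2})$; execute $\mathtt{PlanarCowWalk}(i)$; 4. let $S_1S_2\cdots S_{2^{2i}}$ be the solo execution of $\mathtt{CGKK}$ during time $2^i$, cut into pieces of duration $2^{-i}$; execute $S_1\,wait(2^i)\,S_2\,wait(2^i)\cdots S_{2^{2i}}\,wait(2^i)$; backtrack along the path followed in this execution. (Backtracking traverses the path in the reverse direction, without the waiting periods.) **Theorem.** CGKK procedures and Latecomers procedures exist, and for every choice of a CGKK procedure and of a Latecomers procedure the single deterministic algorithm $\mathtt{AlmostUniversalRV}$ built from them guarantees rendezvous for every instance $(r,x,y,\phi,\tau,v,t,\chi)$ that is non-synchronous or satisfies one of - $\chi=1$ and $\phi\ne0$; - $\chi=1$, $\phi=0$ and $t>dist((0,0),(x,y))-r$; - $\chi=-1$ and $t>dist(proj_A,proj_B)-r$. -/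

import Mathlib

open scoped NNReal

noncomputable section

namespace PlaneRV

/-! ### Move instructions and programs

The plane of a coordinate system is identified with `ℂ` (with its Euclidean distance): the point with
coordinates `(a, b)` is `a + b i`.  Everything in this part is expressed in the private units of the
executing agent: its length unit is the distance that it travels in its time unit, so that, in these
units, it moves at speed `1`. -/

/-- The two kinds of instructions: `go θ d` moves along a straight segment of length `d` in the
direction that makes the (counterclockwise) angle `θ` with the private `x`-axis; `wait z` stays idle
for time `z`. -/
inductive Instr where
  | go (θ : ℝ) (d : ℝ≥0) : Instr
  | wait (z : ℝ≥0) : Instr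

namespace Instr

/-- Time needed to execute an instruction. -/
def duration : Instr → ℝ≥0
  | go _ d => d
  | wait z => z

/-- The same kind of instruction (same direction), lasting time `z`. -/
def withDuration : Instr → ℝ≥0 → Instr
  | go θ _, z => go θ z
  | wait _, z => wait z

/-- The displacement of the agent after it has been executing the instruction for time `s`. -/
def displacement : Instr → ℝ≥0 → ℂ
  | go θ _, s => (s : ℝ) * Complex.exp (θ * Complex.I)
  | wait _, _ => 0

/-- The instruction, read in the system `Rot(α)`, i.e. the private system rotated
counterclockwise by the angle `α`. -/
def rotate (α : ℝ) : Instr → Instr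
  | go θ d => go (θ + α) d
  | wait z => wait z

/-- The reversed instruction in a backtrack: segments are traversed in the opposite direction,
waiting periods leave no trace on the path. -/
def reverse? : Instr → Option Instr
  | go θ d => some (go (θ + Real.pi) d)
  | wait _ => none

end Instr

/-- The four cardinal moves. -/
def goE (d : ℝ≥0) : Instr := .go 0 d
def goN (d : ℝ≥0) : Instr := .go (Real.pi / 2) d
def goW (d : ℝ≥0) : Instr := .go Real.pi d
def goS (d : ℝ≥0) : Instr := .go (3 * Real.pi / 2) d

/-- Total time of a finite sequence of instructions. -/
def totalTime (l : List Instr) : ℝ≥0 := (l.map Instr.duration).sum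

/-- Position, relative to the starting point, of an agent that has been executing a finite sequence
of instructions for time `s` (it stays at the last point when the sequence is finished). -/
def walk : List Instr → ℝ≥0 → ℂ
  | [], _ => 0
  | a :: l, s =>
      if s ≤ a.duration then a.displacement s
      else a.displacement a.duration + walk l (s - a.duration)

/-- The part of the execution of a finite sequence during its first `T` time units. -/
def takeTime : ℝ≥0 → List Instr → List Instr
  | _, [] => []
  | T, a :: l =>
      if a.duration ≤ T then a :: takeTime (T - a.duration) l else [a.withDuration T]

/-- What remains of the execution of a finite sequence after its first `T` time units. -/
def dropTime : ℝ≥0 → List Instr → List Instr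
  | _, [] => []
  | T, a :: l =>
      if a.duration ≤ T then dropTime (T - a.duration) l else a.withDuration (a.duration - T) :: l

/-- Go back along the path followed by a finite sequence of instructions. -/
def backtrack (l : List Instr) : List Instr := l.reverse.filterMap Instr.reverse?

/-- A (deterministic) program: an infinite sequence of instructions whose execution goes on for
ever.  It is meant to be interrupted as soon as the other agent is seen; until then nothing
distinguishes the two agents, so that the sequence is fixed in advance.  (A program that stops is
one that waits for ever from some point on.) -/
structure Program where
  instr : ℕ → Instr
  unbounded : ∀ T : ℝ≥0, ∃ n : ℕ, T ≤ totalTime ((List.range n).map instr)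

namespace Program

open Classical in
/-- The shortest prefix of the program whose execution lasts at least time `T`. -/
def initialPart (p : Program) (T : ℝ≥0) : List Instr :=
  (List.range (Nat.find (p.unbounded T))).map p.instr

/-- Solo execution of the program: the position, in the private coordinate system, at private
time `s` after the wake-up. -/
def pos (p : Program) (s : ℝ≥0) : ℂ := walk (p.initialPart s) s

/-- The solo execution of the program during time `T`, as a finite sequence of instructions. -/
def during (p : Program) (T : ℝ≥0) : List Instr := takeTime T (p.initialPart T)

/-- The instruction number `n` of the infinite concatenation `b 0, b 1, b 2, …`
of nonempty finite sequences. -/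
def concatInstr (b : ℕ → List Instr) (n : ℕ) : Instr :=
  ((List.range (n + 1)).flatMap b)[n]?.getD (.wait 0)

theorem concatInstr_prefix (b : ℕ → List Instr) (hb : ∀ i, b i ≠ []) (m : ℕ) :
    (List.range ((List.range m).flatMap b).length).map (concatInstr b)
      = (List.range m).flatMap b := by
  have hlen : ∀ k, k ≤ ((List.range k).flatMap b).length := by
    intro k
    induction k with
    | zero => simp
    | succ k ih =>
      have := List.length_pos_iff.mpr (hb k)
      rw [List.range_succ, List.flatMap_append, List.length_append]
      simp only [List.flatMap_cons, List.flatMap_nil, List.append_nil]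
      omega
  have hpre : ∀ k l, k ≤ l → (List.range k).flatMap b <+: (List.range l).flatMap b := by
    intro k l hkl
    obtain ⟨d, rfl⟩ := Nat.exists_eq_add_of_le hkl
    rw [List.range_add, List.flatMap_append]
    exact List.prefix_append _ _
  apply List.ext_getElem
  · simp
  · intro k h1 h2
    have hk : k < ((List.range (k + 1)).flatMap b).length := hlen (k + 1)
    simp only [List.getElem_map, List.getElem_range, concatInstr]
    rw [List.getElem?_eq_getElem hk, Option.getD_some]
    rcases le_total (k + 1) m with h | h
    · exact (hpre _ _ h).getElem hk
    · exact ((hpre _ _ h).getElem h2).symm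

/-- The program that executes successively the finite sequences `b 0, b 1, b 2, …`. -/
def concat (b : ℕ → List Instr) (hb : ∀ i, 1 ≤ totalTime (b i)) : Program where
  instr := concatInstr b
  unbounded := by
    intro T
    have hne : ∀ i, b i ≠ [] := by
      intro i h
      have := hb i
      rw [h] at this
      simp [totalTime] at this
    have htot : ∀ m : ℕ, (m : ℝ≥0) ≤ totalTime ((List.range m).flatMap b) := by
      intro m
      induction m with
      | zero => simp
      | succ m ih =>
        rw [List.range_succ, List.flatMap_append]
        simp only [totalTime, List.flatMap_cons, List.flatMap_nil, List.append_nil,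
          List.map_append, List.sum_append, Nat.cast_add, Nat.cast_one] at ih ⊢
        exact add_le_add ih (hb m)
    obtain ⟨m, hm⟩ := exists_nat_ge T
    refine ⟨((List.range m).flatMap b).length, ?_⟩
    rw [concatInstr_prefix b hne]
    exact hm.trans (htot m)

end Program

/-! ### Instances and executions -/

/-- An instance `(r, x, y, φ, τ, v, t, χ)`: visibility radius, and the attributes of agent `B` in the
system of agent `A` (initial position, rotation and chirality of its coordinate system, length of
its time unit, speed, and delay of its wake-up).  The elements of `ℤˣ` are `1` and `-1`. -/
structure Instance where
  r : ℝ
  x : ℝ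
  y : ℝ
  φ : ℝ
  τ : ℝ
  v : ℝ
  t : ℝ
  χ : ℤˣ
  r_pos : 0 < r
  φ_nonneg : 0 ≤ φ
  φ_lt : φ < 2 * Real.pi
  τ_pos : 0 < τ
  v_pos : 0 < v
  t_nonneg : 0 ≤ t

namespace Instance

variable (I : Instance)

/-- The initial positions of the agents. -/
def startA : ℂ := 0
def startB : ℂ := ⟨I.x, I.y⟩

/-- Same clock rates and same speeds. -/
def Synchronous : Prop := I.τ = 1 ∧ I.v = 1

/-- The canonical line: it is parallel to the bisectrix of the angle between the `x`-axes of the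
agents (to their common direction if `φ = 0`) and passes through the middle of their initial
positions, which makes it equidistant from these. -/
def canonicalLine : AffineSubspace ℝ ℂ :=
  AffineSubspace.mk' (midpoint ℝ startA I.startB)
    (Submodule.span ℝ {Complex.exp ((I.φ / 2 : ℝ) * Complex.I)})

instance : Nonempty I.canonicalLine := by
  unfold canonicalLine; infer_instance

/-- Orthogonal projections of the initial positions of the agents on the canonical line. -/
def projA : ℂ := EuclideanGeometry.orthogonalProjection I.canonicalLine startA
def projB : ℂ := EuclideanGeometry.orthogonalProjection I.canonicalLine I.startB

/-- The point of the plane (in the system and units of `A`) whose coordinates in the private system of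
`B`, measured in the length unit `τ v` of `B`, are those of `w`. -/
def fromB (w : ℂ) : ℂ :=
  I.startB + (I.τ * I.v : ℝ) * (Complex.exp (I.φ * Complex.I) * ⟨w.re, (I.χ : ℤ) * w.im⟩)

/-- Positions at time `s` (in the system and units of `A`; time `0` is the wake-up of `A`) if the
agents execute the program without ever being interrupted.  Agent `B` is idle until time `t`. -/
def soloA (p : Program) (s : ℝ≥0) : ℂ := p.pos s
def soloB (p : Program) (s : ℝ≥0) : ℂ := I.fromB (p.pos (Real.toNNReal ((s - I.t) / I.τ)))

/-- The times at which the uninterrupted agents are within sight of each other. -/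
def sightTimes (p : Program) : Set ℝ≥0 := {s | dist (soloA p s) (I.soloB p s) ≤ I.r}

open Classical in
/-- The time until which the program has been executed at time `s`: the execution is interrupted for
ever as soon as the agents see each other. -/
def effectiveTime (p : Program) (s : ℝ≥0) : ℝ≥0 :=
  if (I.sightTimes p).Nonempty then min s (sInf (I.sightTimes p)) else s

/-- Actual positions of the agents at time `s`. -/
def posA (p : Program) (s : ℝ≥0) : ℂ := soloA p (I.effectiveTime p s)
def posB (p : Program) (s : ℝ≥0) : ℂ := I.soloB p (I.effectiveTime p s)

/-- Rendezvous: from some time on, the agents are at distance at most `r` and never move. -/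
def Rendezvous (p : Program) : Prop :=
  ∃ z : ℝ≥0, ∀ s : ℝ≥0, z ≤ s →
    dist (I.posA p s) (I.posB p s) ≤ I.r ∧ I.posA p s = I.posA p z ∧ I.posB p s = I.posB p z

end Instance

/-! ### The two procedures from the literature, through the instances which they have to handle -/

/-- A program has the guarantee of `CGKK`: rendezvous for all instances with simultaneous wake-up that
are not synchronous, or have different orientations and equal chiralities. -/
def IsCGKK (p : Program) : Prop :=
  ∀ I : Instance, I.t = 0 → (¬ I.Synchronous ∨ (I.φ ≠ 0 ∧ I.χ = 1)) → I.Rendezvous p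

/-- A program has the guarantee of `Latecomers`: rendezvous for all synchronous instances in which the
coordinate systems are shifts of each other and `t > dist((0,0),(x,y)) - r`. -/
def IsLatecomers (p : Program) : Prop :=
  ∀ I : Instance, I.Synchronous → I.φ = 0 → I.χ = 1 →
    dist Instance.startA I.startB - I.r < I.t → I.Rendezvous p

/-! ### The algorithm `AlmostUniversalRV` -/

/-- Steps `j = 1, …, i`: `go (E, 2^j); go (W, 2^(j+1)); go (E, 2^j)`. -/
def linearCowWalk (i : ℕ) : List Instr :=
  (List.range i).flatMap fun k =>
    [goE (2 ^ (k + 1)), goW (2 ^ (k + 2)), goE (2 ^ (k + 1))]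

def planarCowWalk (i : ℕ) : List Instr :=
  linearCowWalk i
    ++ (List.replicate (2 ^ (2 * i)) (goN (1 / 2 ^ i) :: linearCowWalk i)).flatten
    ++ [goS (2 ^ i)]
    ++ (List.replicate (2 ^ (2 * i)) (goS (1 / 2 ^ i) :: linearCowWalk i)).flatten
    ++ [goN (2 ^ i)]

/-- First block: `PlanarCowWalk(i)` in `Rot(jπ/2^i)`, for `j = 1, …, 2^(i+1)`. -/
def block₁ (i : ℕ) : List Instr :=
  (List.range (2 ^ (i + 1))).flatMap fun k =>
    (planarCowWalk i).map (Instr.rotate (((k + 1 : ℕ) : ℝ) * Real.pi / 2 ^ i))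

/-- Second block: `wait(2^i)`, `Latecomers` during time `2^i`, backtrack. -/
def block₂ (latecomers : Program) (i : ℕ) : List Instr :=
  [.wait (2 ^ i)] ++ latecomers.during (2 ^ i) ++ backtrack (latecomers.during (2 ^ i))

/-- Third block: `wait(2^(15 i^2))`, `PlanarCowWalk(i)`. -/
def block₃ (i : ℕ) : List Instr :=
  [.wait (2 ^ (15 * i ^ 2))] ++ planarCowWalk i

/-- The `(j+1)`-th of the segments of duration `1/2^i` into which the solo execution
of `CGKK` during time `2^i` is cut. -/
def segment (cgkk : Program) (i j : ℕ) : List Instr :=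
  takeTime (1 / 2 ^ i) (dropTime (j / 2 ^ i) (cgkk.during (2 ^ i)))

/-- The solo execution of `CGKK` during time `2^i`, with `wait(2^i)` after each segment. -/
def segmentedCGKK (cgkk : Program) (i : ℕ) : List Instr :=
  (List.range (2 ^ (2 * i))).flatMap fun j => segment cgkk i j ++ [.wait (2 ^ i)]

/-- Fourth block: segmented execution of `CGKK`, backtrack. -/
def block₄ (cgkk : Program) (i : ℕ) : List Instr :=
  segmentedCGKK cgkk i ++ backtrack (segmentedCGKK cgkk i)

/-- The `i`-th iteration of the main loop. -/
def phase (cgkk latecomers : Program) (i : ℕ) : List Instr :=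
  block₁ i ++ block₂ latecomers i ++ block₃ i ++ block₄ cgkk i

theorem one_le_totalTime_phase (cgkk latecomers : Program) (i : ℕ) :
    1 ≤ totalTime (phase cgkk latecomers i) := by
  have h : (2 : ℝ≥0) ^ i ≤ totalTime (phase cgkk latecomers i) := by
    apply List.single_le_sum (by simp)
    refine List.mem_map.mpr ⟨.wait (2 ^ i), ?_, rfl⟩
    simp [phase, block₂]
  exact (one_le_pow₀ (by norm_num)).trans h

/-- Phases `i = 1, 2, 3, …`, until the other agent is seen. -/
def almostUniversalRV (cgkk latecomers : Program) : Program :=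
  Program.concat (fun k => phase cgkk latecomers (k + 1))
    (fun k => one_le_totalTime_phase cgkk latecomers (k + 1))

end PlaneRV

end

noncomputable section
namespace PlaneRV

open Filter Topology

/-! ### Finite sequences of instructions -/

/-! Since the sight times form a closed set, rendezvous just means that the two uninterrupted
trajectories come within `r` of each other at some time (`rendezvous_iff`). So it suffices to
exhibit private times a of A and b of B with a = t + τ b at which the positions are close
(`rendezvous_of_local_times`). Every block of a phase is a closed loop, so each block starts at the
agent's initial position, and each class of instances is settled by one block of a sufficiently late
phase.

Different clock rates (`rendezvous_of_block₃`): the wait of length 2^(15n²) dwarfs both all earlier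
activity and the cow walk that follows it. Because of the clock drift, the agent with the faster
clock performs its whole cow walk while the other is still waiting at its starting point, and the
cow walks come arbitrarily near every point.

Equal clock rates, and different speeds or a nontrivial rotation (`rendezvous_of_block₄`): without
delay, `CGKK` would bring the agents within r/2 at some time s. With s rounded up to a multiple of
2^(-n), they are still within r; the waits of length 2^n ≥ t make both agents stand at the ends of
the same segment at one moment.

Synchronous shifted systems (`rendezvous_of_block₂`): the preliminary wait absorbs the delay, so the
solo meeting of `Latecomers` is reproduced exactly.

Synchronous, opposite chirality (`rendezvous_of_block₁`): in the frame turned by φ/2, B's change of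
coordinates is q ↦ z + conj q. A walk along the canonical line in A's system is thus a walk along
the same line in B's. On an excursion out and back, A is u past the turning point when B is w before
it, with u + w = t; the gap w - u takes every value in [-t, t], so it can compensate the separation
of the projections up to less than r (`exists_delay_split`). Some walk of the block is almost this
ideal one, and the sight condition is open.

A `CGKK` procedure is obtained by repeating `block₃`: unequal clocks as above; with equal clocks
some point has the same coordinates in both systems, and a dense trajectory approaches it. A
`Latecomers` procedure goes out and back in all rational directions, to all integer distances ≥ 1.
-/

/-- The displacement of the agent once a finite sequence has been executed. -/
def netDisplacement (l : List Instr) : ℂ := (l.map fun a => a.displacement a.duration).sum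

@[simp] theorem totalTime_nil : totalTime [] = 0 := rfl

@[simp] theorem totalTime_cons (a : Instr) (l : List Instr) :
    totalTime (a :: l) = a.duration + totalTime l := by
  simp [totalTime]

@[simp] theorem totalTime_append (l₁ l₂ : List Instr) :
    totalTime (l₁ ++ l₂) = totalTime l₁ + totalTime l₂ := by
  simp [totalTime]

@[simp] theorem netDisplacement_nil : netDisplacement [] = 0 := rfl

@[simp] theorem netDisplacement_cons (a : Instr) (l : List Instr) :
    netDisplacement (a :: l) = a.displacement a.duration + netDisplacement l := by
  simp [netDisplacement]

@[simp] theorem netDisplacement_append (l₁ l₂ : List Instr) :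
    netDisplacement (l₁ ++ l₂) = netDisplacement l₁ + netDisplacement l₂ := by
  simp [netDisplacement]

theorem totalTime_flatMap_range_succ (b : ℕ → List Instr) (n : ℕ) :
    totalTime ((List.range (n + 1)).flatMap b)
      = totalTime ((List.range n).flatMap b) + totalTime (b n) := by
  simp [List.range_succ, List.flatMap_append]

theorem netDisplacement_flatMap_range_succ (b : ℕ → List Instr) (n : ℕ) :
    netDisplacement ((List.range (n + 1)).flatMap b)
      = netDisplacement ((List.range n).flatMap b) + netDisplacement (b n) := by
  simp [List.range_succ, List.flatMap_append]

theorem netDisplacement_flatMap_eq_zero {b : ℕ → List Instr}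
    (hb : ∀ n, netDisplacement (b n) = 0) (m : ℕ) :
    netDisplacement ((List.range m).flatMap b) = 0 := by
  induction m with
  | zero => simp
  | succ m ih => rw [netDisplacement_flatMap_range_succ, ih, hb, add_zero]

theorem totalTime_flatMap_range_const {b : ℕ → List Instr} {c : ℝ≥0} (n : ℕ)
    (hb : ∀ k < n, totalTime (b k) = c) :
    totalTime ((List.range n).flatMap b) = n * c := by
  induction n with
  | zero => simp
  | succ n ih =>
    rw [totalTime_flatMap_range_succ, ih fun k hk => hb k (by omega), hb n (by omega)]
    push_cast; ring

theorem flatMap_range_split {α : Type*} (b : ℕ → List α) {k n : ℕ} (hk : k < n) :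
    ∃ l, (List.range n).flatMap b = (List.range k).flatMap b ++ b k ++ l := by
  obtain ⟨d, rfl⟩ := Nat.exists_eq_add_of_lt hk
  rw [Nat.add_right_comm, List.range_add, List.flatMap_append, List.range_succ,
    List.flatMap_append]
  exact ⟨(List.map (fun x => k + 1 + x) (List.range d)).flatMap b, by simp⟩

theorem replicate_flatten_split {α : Type*} (l : List α) {k n : ℕ} (hk : k < n) :
    ∃ l', (List.replicate n l).flatten = (List.replicate k l).flatten ++ l ++ l' := by
  obtain ⟨d, rfl⟩ := Nat.exists_eq_add_of_lt hk
  refine ⟨(List.replicate d l).flatten, ?_⟩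
  rw [Nat.add_right_comm, List.replicate_add, List.replicate_succ', List.flatten_append,
    List.flatten_append]
  simp

theorem totalTime_replicate_flatten (n : ℕ) (l : List Instr) :
    totalTime (List.replicate n l).flatten = n * totalTime l := by
  induction n with
  | zero => simp
  | succ n ih => simp [List.replicate_succ, ih]; ring

theorem netDisplacement_replicate_flatten (n : ℕ) (l : List Instr) :
    netDisplacement (List.replicate n l).flatten = n * netDisplacement l := by
  induction n with
  | zero => simp
  | succ n ih => simp [List.replicate_succ, ih]; ring

namespace Instr

@[simp] theorem displacement_zero (a : Instr) : a.displacement 0 = 0 := by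
  cases a <;> simp [displacement]

theorem displacement_add (a : Instr) (s s' : ℝ≥0) :
    a.displacement (s + s') = a.displacement s + a.displacement s' := by
  cases a <;> simp [displacement, add_mul]

theorem continuous_displacement (a : Instr) : Continuous a.displacement := by
  cases a with
  | go θ d => unfold displacement; fun_prop
  | wait z => exact continuous_const

@[simp] theorem duration_withDuration (a : Instr) (z : ℝ≥0) : (a.withDuration z).duration = z := by
  cases a <;> rfl

@[simp] theorem displacement_withDuration (a : Instr) (z s : ℝ≥0) :
    (a.withDuration z).displacement s = a.displacement s := by
  cases a <;> rfl

@[simp] theorem duration_rotate (a : Instr) (α : ℝ) : (a.rotate α).duration = a.duration := by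
  cases a <;> rfl

theorem displacement_rotate (a : Instr) (α : ℝ) (s : ℝ≥0) :
    (a.rotate α).displacement s = Complex.exp (α * Complex.I) * a.displacement s := by
  cases a with
  | go θ d => simp only [rotate, displacement]; push_cast; rw [add_mul, Complex.exp_add]; ring
  | wait z => simp [rotate, displacement]

end Instr

@[simp] theorem walk_zero (l : List Instr) : walk l 0 = 0 := by
  cases l <;> simp [walk]

theorem walk_cons_of_le {a : Instr} {s : ℝ≥0} (l : List Instr) (h : s ≤ a.duration) :
    walk (a :: l) s = a.displacement s := by
  simp [walk, h]

/-- At s = 0 both sides sit on the boundary between two instructions, where the first branch of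
`walk` applies; they agree because a walk starts at 0. -/
theorem walk_cons_add (a : Instr) (l : List Instr) (s : ℝ≥0) :
    walk (a :: l) (a.duration + s) = a.displacement a.duration + walk l s := by
  rcases eq_or_ne s 0 with rfl | h
  · simp [walk]
  · have : ¬ a.duration + s ≤ a.duration := by simpa using h
    rw [walk, if_neg this, add_tsub_cancel_left]

theorem walk_append_add (l₁ l₂ : List Instr) (s : ℝ≥0) :
    walk (l₁ ++ l₂) (totalTime l₁ + s) = netDisplacement l₁ + walk l₂ s := by
  induction l₁ with
  | nil => simp
  | cons a l ih => simp [add_assoc, walk_cons_add, ih]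

theorem walk_append_of_le {l₁ : List Instr} (l₂ : List Instr) {s : ℝ≥0} (h : s ≤ totalTime l₁) :
    walk (l₁ ++ l₂) s = walk l₁ s := by
  induction l₁ generalizing s with
  | nil => simp_all
  | cons a l ih =>
    rcases le_total s a.duration with hs | hs
    · simp [walk_cons_of_le, hs]
    · obtain ⟨u, rfl⟩ := exists_add_of_le hs
      rw [List.cons_append, walk_cons_add, walk_cons_add, ih]
      simpa using h

theorem walk_of_totalTime_le {l : List Instr} {s : ℝ≥0} (h : totalTime l ≤ s) :
    walk l s = netDisplacement l := by
  obtain ⟨u, rfl⟩ := exists_add_of_le h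
  simpa [walk] using walk_append_add l [] u

theorem continuous_walk (l : List Instr) : Continuous (walk l) := by
  induction l with
  | nil => exact continuous_const
  | cons a l ih =>
    refine Continuous.if_le a.continuous_displacement ?_ continuous_id continuous_const ?_
    · exact continuous_const.add (ih.comp (continuous_id.sub continuous_const))
    · rintro s rfl
      simp

/-! ### Rotated walks -/

theorem totalTime_rotate (α : ℝ) (l : List Instr) :
    totalTime (l.map (Instr.rotate α)) = totalTime l := by
  induction l with
  | nil => rfl
  | cons a l ih => simp [ih]

theorem netDisplacement_rotate (α : ℝ) (l : List Instr) :
    netDisplacement (l.map (Instr.rotate α))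
      = Complex.exp (α * Complex.I) * netDisplacement l := by
  induction l with
  | nil => simp
  | cons a l ih => simp [ih, Instr.displacement_rotate, mul_add]

theorem walk_rotate (α : ℝ) (l : List Instr) (s : ℝ≥0) :
    walk (l.map (Instr.rotate α)) s = Complex.exp (α * Complex.I) * walk l s := by
  induction l generalizing s with
  | nil => simp [walk]
  | cons a l ih =>
    simp only [List.map_cons, walk, Instr.duration_rotate, Instr.displacement_rotate, ih]
    split_ifs <;> ring

/-! ### Cutting a sequence at a given time -/

theorem totalTime_takeTime (T : ℝ≥0) (l : List Instr) :
    totalTime (takeTime T l) = min T (totalTime l) := by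
  induction l generalizing T with
  | nil => simp [takeTime]
  | cons a l ih =>
    rw [takeTime]
    split_ifs with h
    · obtain ⟨u, rfl⟩ := exists_add_of_le h
      simp [ih, min_add_add_left]
    · simp [min_eq_left ((not_le.mp h).le.trans le_self_add)]

theorem walk_takeTime {T s : ℝ≥0} (l : List Instr) (h : s ≤ T) :
    walk (takeTime T l) s = walk l s := by
  induction l generalizing T s with
  | nil => simp [takeTime]
  | cons a l ih =>
    rw [takeTime]
    split_ifs with hT
    · rcases le_total s a.duration with hs | hs
      · simp [walk_cons_of_le, hs]
      · obtain ⟨u, rfl⟩ := exists_add_of_le hs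
        rw [walk_cons_add, walk_cons_add, ih]
        exact le_tsub_of_add_le_left h
    · rw [walk_cons_of_le _ (by simpa using h), walk_cons_of_le _ (h.trans (not_le.mp hT).le)]
      simp

theorem netDisplacement_takeTime (T : ℝ≥0) (l : List Instr) :
    netDisplacement (takeTime T l) = walk l T := by
  rw [← walk_takeTime l le_rfl, walk_of_totalTime_le]
  rw [totalTime_takeTime]
  exact min_le_left _ _

theorem walk_dropTime (T s : ℝ≥0) (l : List Instr) :
    walk (dropTime T l) s = walk l (T + s) - walk l T := by
  induction l generalizing T s with
  | nil => simp [dropTime, walk]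
  | cons a l ih =>
    rw [dropTime]
    split_ifs with h
    · obtain ⟨u, rfl⟩ := exists_add_of_le h
      simp [ih, add_assoc, walk_cons_add]
    · obtain ⟨u, hu⟩ := exists_add_of_le (not_le.mp h).le
      rw [walk_cons_of_le l (not_le.mp h).le, hu, add_tsub_cancel_left]
      rcases le_total s u with hs | hs
      · rw [walk_cons_of_le _ (by simpa using hs), walk_cons_of_le _ (by rw [hu]; gcongr),
          Instr.displacement_withDuration, Instr.displacement_add]
        ring
      · obtain ⟨w, rfl⟩ := exists_add_of_le hs
        rw [← add_assoc, ← hu, walk_cons_add]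
        have := walk_cons_add (a.withDuration u) l w
        simp only [Instr.duration_withDuration, Instr.displacement_withDuration] at this
        rw [this, hu, Instr.displacement_add]
        ring

/-! ### Backtracking -/

theorem Instr.displacement_reverse (θ : ℝ) (d s : ℝ≥0) :
    (Instr.go (θ + Real.pi) d).displacement s = -(Instr.go θ d).displacement s := by
  simp only [Instr.displacement]
  push_cast
  rw [add_mul, Complex.exp_add, Complex.exp_pi_mul_I]
  ring

theorem backtrack_cons (a : Instr) (l : List Instr) :
    backtrack (a :: l) = backtrack l ++ (a.reverse?).toList := by
  simp only [backtrack, List.reverse_cons, List.filterMap_append]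
  cases a <;> simp [Instr.reverse?]

theorem netDisplacement_backtrack (l : List Instr) :
    netDisplacement (backtrack l) = -netDisplacement l := by
  induction l with
  | nil => simp [backtrack]
  | cons a l ih =>
    rw [backtrack_cons, netDisplacement_append, ih]
    cases a with
    | go θ d =>
      simp only [Instr.reverse?, Option.toList_some, netDisplacement_cons, netDisplacement_nil,
        Instr.duration, Instr.displacement_reverse]
      ring
    | wait z => simp [Instr.reverse?, Instr.displacement]

/-- Only an inequality: the waiting periods are dropped. -/
theorem totalTime_backtrack_le (l : List Instr) : totalTime (backtrack l) ≤ totalTime l := by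
  induction l with
  | nil => simp [backtrack]
  | cons a l ih =>
    rw [backtrack_cons, totalTime_append, totalTime_cons, add_comm]
    refine add_le_add ?_ ih
    cases a <;> simp [Instr.reverse?, Instr.duration]

/-! ### Programs -/

namespace Program

/-- Instructions beyond the shortest prefix lasting time s do not affect the position at s. This
lets one fixed prefix serve for many times. -/
theorem pos_eq_walk (p : Program) {s : ℝ≥0} {n : ℕ}
    (h : s ≤ totalTime ((List.range n).map p.instr)) :
    p.pos s = walk ((List.range n).map p.instr) s := by
  classical
  have hle : Nat.find (p.unbounded s) ≤ n := Nat.find_min' _ h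
  obtain ⟨d, hd⟩ := Nat.exists_eq_add_of_le hle
  rw [pos, initialPart, hd, List.range_add, List.map_append,
    walk_append_of_le _ (Nat.find_spec (p.unbounded s))]

theorem continuous_pos (p : Program) : Continuous p.pos := by
  rw [continuous_iff_continuousAt]
  intro s
  -- The prefix defining `pos` varies with the time; a prefix of duration at least s + 1 works
  -- throughout a neighbourhood of s.
  obtain ⟨n, hn⟩ := p.unbounded (s + 1)
  have hs : s < s + 1 := lt_add_of_pos_right _ one_pos
  refine (continuous_walk ((List.range n).map p.instr)).continuousAt.congr ?_
  filter_upwards [Iio_mem_nhds hs] with u hu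
  exact (p.pos_eq_walk ((le_of_lt hu).trans hn)).symm

theorem le_totalTime_initialPart (p : Program) (T : ℝ≥0) : T ≤ totalTime (p.initialPart T) := by
  classical
  exact Nat.find_spec (p.unbounded T)

theorem totalTime_during (p : Program) (T : ℝ≥0) : totalTime (p.during T) = T := by
  rw [during, totalTime_takeTime, min_eq_left (p.le_totalTime_initialPart T)]

theorem walk_during (p : Program) {s T : ℝ≥0} (h : s ≤ T) : walk (p.during T) s = p.pos s := by
  rw [during, walk_takeTime _ h]
  exact (p.pos_eq_walk (h.trans (p.le_totalTime_initialPart T))).symm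

/-- From time `T` on, the program executes the sequence `l`, starting at the point `c`. -/
def Runs (p : Program) (T : ℝ≥0) (c : ℂ) (l : List Instr) : Prop :=
  ∀ s ≤ totalTime l, p.pos (T + s) = c + walk l s

theorem Runs.left {p : Program} {T : ℝ≥0} {c : ℂ} {l₁ l₂ : List Instr}
    (h : p.Runs T c (l₁ ++ l₂)) : p.Runs T c l₁ := fun s hs => by
  rw [h s (hs.trans (by simp)), walk_append_of_le _ hs]

theorem Runs.right {p : Program} {T : ℝ≥0} {c : ℂ} {l₁ l₂ : List Instr}
    (h : p.Runs T c (l₁ ++ l₂)) :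
    p.Runs (T + totalTime l₁) (c + netDisplacement l₁) l₂ := fun s hs => by
  rw [add_assoc, h _ (by simpa using hs), walk_append_add, add_assoc]

theorem runs_concat {b : ℕ → List Instr} (hb : ∀ i, 1 ≤ totalTime (b i)) (m : ℕ) :
    (concat b hb).Runs (totalTime ((List.range m).flatMap b))
      (netDisplacement ((List.range m).flatMap b)) (b m) := by
  intro s hs
  have hne : ∀ i, b i ≠ [] := by
    intro i h
    have := hb i
    simp [h] at this
  have hpre := concatInstr_prefix b hne (m + 1)
  have hle : totalTime ((List.range m).flatMap b) + s
      ≤ totalTime ((List.range (m + 1)).flatMap b) := by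
    rw [totalTime_flatMap_range_succ]
    gcongr
  have hpos := (concat b hb).pos_eq_walk (s := totalTime ((List.range m).flatMap b) + s)
    (n := ((List.range (m + 1)).flatMap b).length) (by
      change _ ≤ totalTime (List.map (concatInstr b) _)
      rw [hpre]; exact hle)
  rw [hpos]
  change walk (List.map (concatInstr b) _) _ = _
  rw [hpre, List.range_succ, List.flatMap_append, walk_append_add]
  simp

end Program

/-! ### Rendezvous and sight -/

namespace Instance

/-- The linear part of the change of coordinates of agent `B`. -/
def linB (I : Instance) : ℂ →ₗ[ℝ] ℂ where
  toFun w := (I.τ * I.v : ℝ) * (Complex.exp (I.φ * Complex.I) * ⟨w.re, (I.χ : ℤ) * w.im⟩)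
  map_add' z w := by
    rw [← mul_add, ← mul_add]
    congr 2
    apply Complex.ext <;> simp [mul_add]
  map_smul' c w := by
    have : (⟨(c • w).re, (I.χ : ℤ) * (c • w).im⟩ : ℂ) = c * ⟨w.re, (I.χ : ℤ) * w.im⟩ := by
      apply Complex.ext <;> simp
      ring
    rw [this, RingHom.id_apply, Complex.real_smul]
    ring

theorem fromB_eq (I : Instance) (w : ℂ) : I.fromB w = I.startB + I.linB w := rfl

theorem norm_linB (I : Instance) (w : ℂ) : ‖I.linB w‖ = I.τ * I.v * ‖w‖ := by
  have h : ‖(⟨w.re, (I.χ : ℤ) * w.im⟩ : ℂ)‖ = ‖w‖ := by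
    rcases Int.units_eq_one_or I.χ with h | h <;>
      simp [h, Complex.norm_def, Complex.normSq_apply]
  change ‖((I.τ * I.v : ℝ) : ℂ) * (Complex.exp (I.φ * Complex.I) * ⟨w.re, (I.χ : ℤ) * w.im⟩)‖ = _
  rw [norm_mul, norm_mul, Complex.norm_exp_ofReal_mul_I, h, one_mul, Complex.norm_real,
    Real.norm_of_nonneg (mul_pos I.τ_pos I.v_pos).le]

theorem continuous_fromB (I : Instance) : Continuous I.fromB :=
  continuous_const.add I.linB.continuous_of_finiteDimensional

theorem isClosed_sightTimes (I : Instance) (p : Program) : IsClosed (I.sightTimes p) := by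
  have hA : Continuous (soloA p) := p.continuous_pos
  have hB : Continuous (I.soloB p) :=
    I.continuous_fromB.comp (p.continuous_pos.comp (by fun_prop))
  exact isClosed_le (hA.dist hB) continuous_const

/-- Interruption can be ignored: the closed set of sight times contains its infimum, and both agents
are frozen from that moment on. -/
theorem rendezvous_iff (I : Instance) (p : Program) :
    I.Rendezvous p ↔ ∃ s, dist (soloA p s) (I.soloB p s) ≤ I.r := by
  constructor
  · rintro ⟨z, hz⟩
    exact ⟨_, (hz z le_rfl).1⟩
  · intro hne
    change (I.sightTimes p).Nonempty at hne
    have hmem : sInf (I.sightTimes p) ∈ I.sightTimes p :=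
      (I.isClosed_sightTimes p).csInf_mem hne (OrderBot.bddBelow _)
    have heff : ∀ s, sInf (I.sightTimes p) ≤ s →
        I.effectiveTime p s = sInf (I.sightTimes p) := fun s hs => by
      rw [effectiveTime, if_pos hne, min_eq_right hs]
    refine ⟨sInf (I.sightTimes p), fun s hs => ?_⟩
    simp only [posA, posB, heff s hs, heff _ le_rfl, and_self, and_true]
    exact hmem

/-- A sight time given by the local times `a` and `b` of the two agents. -/
theorem rendezvous_of_local_times {I : Instance} {p : Program} {a b : ℝ≥0}
    (h : (a : ℝ) = I.t + I.τ * b) (hd : dist (p.pos a) (I.fromB (p.pos b)) ≤ I.r) :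
    I.Rendezvous p := by
  refine (I.rendezvous_iff p).2 ⟨a, ?_⟩
  have : Real.toNNReal (((a : ℝ) - I.t) / I.τ) = b := by
    rw [h, add_sub_cancel_left, mul_div_cancel_left₀ _ I.τ_pos.ne', Real.toNNReal_coe]
  rwa [soloB, this]

end Instance

/-! ### Cow walks -/

@[simp] theorem duration_goE (d : ℝ≥0) : (goE d).duration = d := rfl
@[simp] theorem duration_goN (d : ℝ≥0) : (goN d).duration = d := rfl
@[simp] theorem duration_goW (d : ℝ≥0) : (goW d).duration = d := rfl
@[simp] theorem duration_goS (d : ℝ≥0) : (goS d).duration = d := rfl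

@[simp] theorem displacement_goE (d s : ℝ≥0) : (goE d).displacement s = (s : ℝ) := by
  simp [goE, Instr.displacement]

@[simp] theorem displacement_goW (d s : ℝ≥0) : (goW d).displacement s = -((s : ℝ) : ℂ) := by
  simp [goW, Instr.displacement]

@[simp] theorem displacement_goN (d s : ℝ≥0) :
    (goN d).displacement s = (s : ℝ) * Complex.I := by
  simp [goN, Instr.displacement, Complex.exp_pi_div_two_mul_I]

@[simp] theorem displacement_goS (d s : ℝ≥0) :
    (goS d).displacement s = -((s : ℝ) * Complex.I) := by
  have h : Complex.exp (((3 * Real.pi / 2 : ℝ) : ℂ) * Complex.I) = -Complex.I := by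
    have : ((3 * Real.pi / 2 : ℝ) : ℂ) * Complex.I
        = Real.pi / 2 * Complex.I + Real.pi * Complex.I := by
      push_cast; ring
    rw [this, Complex.exp_add, Complex.exp_pi_mul_I, Complex.exp_pi_div_two_mul_I]
    ring
  rw [goS, Instr.displacement, h]
  ring

theorem walk_pair_left {a b : Instr} {s : ℝ≥0} (h : s ≤ a.duration) :
    walk [a, b] s = a.displacement s := walk_cons_of_le _ h

theorem walk_pair_right {a b : Instr} {s : ℝ≥0} (h : s ≤ b.duration) :
    walk [a, b] (a.duration + s) = a.displacement a.duration + b.displacement s := by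
  rw [walk_cons_add, walk_cons_of_le _ h]

theorem netDisplacement_linearCowWalk (i : ℕ) : netDisplacement (linearCowWalk i) = 0 := by
  refine netDisplacement_flatMap_eq_zero (fun k => ?_) i
  simp
  ring

theorem totalTime_linearCowWalk_le (i : ℕ) : totalTime (linearCowWalk i) ≤ 2 ^ (i + 3) := by
  induction i with
  | zero => simp [linearCowWalk]
  | succ i ih =>
    rw [linearCowWalk, totalTime_flatMap_range_succ]
    refine (add_le_add_left ih _).trans (le_of_eq ?_)
    simp
    ring

theorem linearCowWalk_split {i j : ℕ} (hj : j < i) :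
    ∃ l₁ l₂, linearCowWalk i = l₁ ++ [goE (2 ^ (j + 1)), goW (2 ^ (j + 2))] ++ l₂ ∧
      netDisplacement l₁ = 0 := by
  obtain ⟨l, hl⟩ := flatMap_range_split
    (fun k => [goE (2 ^ (k + 1)), goW (2 ^ (k + 2)), goE (2 ^ (k + 1))]) hj
  exact ⟨linearCowWalk j, goE (2 ^ (j + 1)) :: l, by rw [linearCowWalk, hl]; simp [linearCowWalk],
    netDisplacement_linearCowWalk j⟩

theorem netDisplacement_planarCowWalk (i : ℕ) : netDisplacement (planarCowWalk i) = 0 := by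
  have h : ((2 : ℂ) ^ i) ≠ 0 := by simp
  simp only [planarCowWalk, netDisplacement_append, netDisplacement_replicate_flatten,
    netDisplacement_cons, netDisplacement_linearCowWalk, netDisplacement_nil, displacement_goN,
    displacement_goS, duration_goN, duration_goS]
  push_cast
  field_simp
  ring

theorem totalTime_planarCowWalk_le (i : ℕ) : totalTime (planarCowWalk i) ≤ 2 ^ (3 * i + 6) := by
  have hL := totalTime_linearCowWalk_le i
  have h1 : (1 : ℝ≥0) ≤ 2 ^ i := one_le_pow₀ (by norm_num)
  -- A crude bound on the small steps, enough to make everything a multiple of (2^i)^3.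
  have h2 : (1 / 2 ^ i : ℝ≥0) ≤ 2 ^ i := (div_le_self zero_le h1).trans h1
  simp only [planarCowWalk, totalTime_append, totalTime_replicate_flatten,
    totalTime_cons, totalTime_nil, duration_goN, duration_goS]
  push_cast
  calc _ ≤ (2 : ℝ≥0) ^ (i + 3) + 2 ^ (2 * i) * (2 ^ i + 2 ^ (i + 3)) + (2 ^ i + 0)
        + 2 ^ (2 * i) * (2 ^ i + 2 ^ (i + 3)) + (2 ^ i + 0) := by gcongr
    _ = 10 * 2 ^ i + 18 * (2 ^ i) ^ 3 := by ring
    _ ≤ 10 * (2 ^ i) ^ 3 + 18 * (2 ^ i) ^ 3 := by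
      exact add_le_add_left (mul_le_mul_right (le_self_pow₀ h1 (by norm_num)) _) _
    _ = 28 * (2 ^ i) ^ 3 := by ring
    _ ≤ 64 * (2 ^ i) ^ 3 := by gcongr; norm_num
    _ = 2 ^ (3 * i + 6) := by ring

/-- Every multiple of 2^(-i) in [-2^i, 2^i] is the height of a linear cow walk: 0 at the start,
positive heights in the northward half, negative ones in the southward half. -/
theorem planarCowWalk_split_linear (i : ℕ) {k : ℤ} (hk : |k| ≤ 2 ^ (2 * i)) :
    ∃ l₁ l₂, planarCowWalk i = l₁ ++ linearCowWalk i ++ l₂ ∧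
      netDisplacement l₁ = ((k / 2 ^ i : ℝ) : ℂ) * Complex.I := by
  have h2 : ((2 : ℂ) ^ i) ≠ 0 := by simp
  rcases lt_trichotomy k 0 with h | rfl | h
  · obtain ⟨m, rfl⟩ : ∃ m : ℕ, k = -(m + 1 : ℕ) := ⟨(-k).toNat - 1, by omega⟩
    have hm : m < 2 ^ (2 * i) := by
      rw [abs_neg, Nat.abs_cast] at hk
      exact_mod_cast hk
    obtain ⟨l, hl⟩ := replicate_flatten_split (goS (1 / 2 ^ i) :: linearCowWalk i) hm
    refine ⟨linearCowWalk i
        ++ (List.replicate (2 ^ (2 * i)) (goN (1 / 2 ^ i) :: linearCowWalk i)).flatten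
        ++ [goS (2 ^ i)] ++ (List.replicate m (goS (1 / 2 ^ i) :: linearCowWalk i)).flatten
        ++ [goS (1 / 2 ^ i)], l ++ [goN (2 ^ i)], by rw [planarCowWalk, hl]; simp, ?_⟩
    simp only [netDisplacement_append, netDisplacement_replicate_flatten,
      netDisplacement_cons, netDisplacement_linearCowWalk, netDisplacement_nil, displacement_goN,
      displacement_goS, duration_goN, duration_goS]
    push_cast
    field_simp
    ring
  · refine ⟨[], ?_, ?_, by simp⟩
    rotate_left
    · rw [planarCowWalk, List.nil_append]
      simp only [List.append_assoc]
      rfl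
  · obtain ⟨m, rfl⟩ : ∃ m : ℕ, k = (m + 1 : ℕ) := ⟨k.toNat - 1, by omega⟩
    have hm : m < 2 ^ (2 * i) := by
      rw [Nat.abs_cast] at hk
      exact_mod_cast hk
    obtain ⟨l, hl⟩ := replicate_flatten_split (goN (1 / 2 ^ i) :: linearCowWalk i) hm
    refine ⟨linearCowWalk i ++ (List.replicate m (goN (1 / 2 ^ i) :: linearCowWalk i)).flatten
        ++ [goN (1 / 2 ^ i)], l ++ [goS (2 ^ i)]
        ++ (List.replicate (2 ^ (2 * i)) (goS (1 / 2 ^ i) :: linearCowWalk i)).flatten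
        ++ [goN (2 ^ i)], by rw [planarCowWalk, hl]; simp, ?_⟩
    simp only [netDisplacement_append, netDisplacement_replicate_flatten,
      netDisplacement_cons, netDisplacement_linearCowWalk, netDisplacement_nil, displacement_goN,
      duration_goN]
    push_cast
    field_simp
    ring

/-- Isolates one excursion east and back west of a length that does not depend on i, at a prescribed
height. Both the density of the cow walks and the opposite chirality case use only such a pair. -/
theorem planarCowWalk_split {i j : ℕ} (hj : j < i) {k : ℤ} (hk : |k| ≤ 2 ^ (2 * i)) :
    ∃ l₁ l₂, planarCowWalk i = l₁ ++ [goE (2 ^ (j + 1)), goW (2 ^ (j + 2))] ++ l₂ ∧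
      netDisplacement l₁ = ((k / 2 ^ i : ℝ) : ℂ) * Complex.I := by
  obtain ⟨l₁, l₂, h, hnet⟩ := planarCowWalk_split_linear i hk
  obtain ⟨m₁, m₂, h', hnet'⟩ := linearCowWalk_split hj
  exact ⟨l₁ ++ m₁, m₂ ++ l₂, by rw [h, h']; simp, by simp [hnet, hnet']⟩

/-! ### Dyadic approximation and density of the planar cow walks -/

theorem tendsto_floor_mul_two_pow_div (x : ℝ) :
    Tendsto (fun n : ℕ => (⌊x * 2 ^ n⌋ : ℝ) / 2 ^ n) atTop (𝓝 x) := by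
  have hpow : Tendsto (fun n : ℕ => (1 / 2 : ℝ) ^ n) atTop (𝓝 0) :=
    tendsto_pow_atTop_nhds_zero_of_lt_one (by norm_num) (by norm_num)
  refine tendsto_of_tendsto_of_tendsto_of_le_of_le
    (by simpa only [sub_zero] using (tendsto_const_nhds (x := x)).sub hpow) tendsto_const_nhds (fun n => ?_)
    fun n => ?_
  · have h2 : (0 : ℝ) < 2 ^ n := by positivity
    change x - (1 / 2) ^ n ≤ _
    rw [le_div_iff₀ h2, sub_mul, ← mul_pow]
    norm_num
    exact (Int.lt_floor_add_one _).le
  · have h2 : (0 : ℝ) < 2 ^ n := by positivity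
    change _ ≤ x
    rw [div_le_iff₀ h2]
    exact Int.floor_le _

theorem eventually_abs_floor_mul_two_pow_le (x : ℝ) :
    ∀ᶠ n : ℕ in atTop, |⌊x * 2 ^ n⌋| ≤ (2 : ℤ) ^ (2 * n) := by
  have h2 : Tendsto (fun n : ℕ => (2 : ℝ) ^ n) atTop atTop :=
    tendsto_pow_atTop_atTop_of_one_lt (by norm_num)
  filter_upwards [h2.eventually_ge_atTop (|x| + 1)] with n hn
  have h1 : (1 : ℝ) ≤ 2 ^ n := one_le_pow₀ (by norm_num)
  have hf : |(⌊x * 2 ^ n⌋ : ℝ)| ≤ |x * 2 ^ n| + 1 := by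
    have h3 := Int.floor_le (x * 2 ^ n)
    have h4 := Int.lt_floor_add_one (x * 2 ^ n)
    rw [abs_le]
    constructor
    · linarith [neg_abs_le (x * 2 ^ n)]
    · linarith [le_abs_self (x * 2 ^ n)]
  have : |(⌊x * 2 ^ n⌋ : ℝ)| ≤ 2 ^ (2 * n) := by
    calc _ ≤ |x * 2 ^ n| + 1 := hf
      _ = |x| * 2 ^ n + 1 := by rw [abs_mul, abs_of_pos (by positivity : (0 : ℝ) < 2 ^ n)]
      _ ≤ |x| * 2 ^ n + 2 ^ n := by gcongr
      _ = (|x| + 1) * 2 ^ n := by ring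
      _ ≤ 2 ^ n * 2 ^ n := by gcongr
      _ = 2 ^ (2 * n) := by ring
  exact_mod_cast this

/-- The planar cow walks come arbitrarily close to every point. -/
theorem eventually_exists_walk_planarCowWalk_mem {z : ℂ} {U : Set ℂ} (hU : U ∈ 𝓝 z) :
    ∀ᶠ n in atTop, ∃ s ≤ totalTime (planarCowWalk n), walk (planarCowWalk n) s ∈ U := by
  obtain ⟨j, hj⟩ := pow_unbounded_of_one_lt |z.re| (one_lt_two)
  have hlim : Tendsto (fun n : ℕ => (((⌊z.im * 2 ^ n⌋ : ℝ) / 2 ^ n : ℝ) : ℂ) * Complex.I + z.re)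
      atTop (𝓝 z) := by
    have := (Complex.continuous_ofReal.tendsto _).comp (tendsto_floor_mul_two_pow_div z.im)
    have := (this.mul_const Complex.I).add_const (z.re : ℂ)
    rwa [add_comm (_ * _), Complex.re_add_im] at this
  filter_upwards [hlim hU, eventually_abs_floor_mul_two_pow_le z.im, eventually_gt_atTop j]
    with n hn hk hjn
  obtain ⟨l₁, l₂, hl, hnet⟩ := planarCowWalk_split hjn hk
  have hz : |z.re| ≤ 2 ^ (j + 1) := hj.le.trans (pow_le_pow_right₀ one_le_two (by omega))
  -- The abscissa of z is hit exactly on the westward leg, u after the east end; only the height is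
  -- approximated.
  obtain ⟨u, hu⟩ : ∃ u : ℝ≥0, (u : ℝ) = 2 ^ (j + 1) - z.re :=
    ⟨⟨_, sub_nonneg.2 ((le_abs_self _).trans hz)⟩, rfl⟩
  have hu2 : u ≤ 2 ^ (j + 2) := by
    rw [← NNReal.coe_le_coe, hu]
    push_cast
    rw [pow_succ _ (j + 1)]
    linarith [neg_abs_le z.re]
  have hle : 2 ^ (j + 1) + u ≤ totalTime [goE (2 ^ (j + 1)), goW (2 ^ (j + 2))] := by
    simpa using hu2
  refine ⟨totalTime l₁ + (2 ^ (j + 1) + u), ?_, ?_⟩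
  · rw [hl, totalTime_append, totalTime_append]
    exact (add_le_add_right hle _).trans le_self_add
  · rw [hl, List.append_assoc, walk_append_add, walk_append_of_le _ hle, hnet]
    have := walk_pair_right (a := goE (2 ^ (j + 1))) (b := goW (2 ^ (j + 2))) hu2
    rw [duration_goE, displacement_goE, displacement_goW, hu] at this
    rw [this]
    refine Set.mem_of_eq_of_mem ?_ hn
    push_cast
    ring

/-! ### Existence of a `CGKK` procedure -/

namespace Instance

theorem linB_injective (I : Instance) : Function.Injective I.linB := by
  rw [← LinearMap.ker_eq_bot, LinearMap.ker_eq_bot']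
  intro w hw
  have := I.norm_linB w
  rw [hw, norm_zero, eq_comm, mul_eq_zero] at this
  simpa [(mul_pos I.τ_pos I.v_pos).ne'] using this

theorem exists_fromB_eq (I : Instance) (z : ℂ) : ∃ w, I.fromB w = z := by
  obtain ⟨w, hw⟩ := LinearMap.injective_iff_surjective.1 I.linB_injective (z - I.startB)
  exact ⟨w, by rw [fromB_eq, hw]; ring⟩

theorem linB_of_synchronous {I : Instance} (h : I.Synchronous) (hχ : I.χ = 1) (w : ℂ) :
    I.linB w = Complex.exp (I.φ * Complex.I) * w := by
  change ((I.τ * I.v : ℝ) : ℂ) * (Complex.exp (I.φ * Complex.I) * ⟨w.re, (I.χ : ℤ) * w.im⟩) = _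
  have : (⟨w.re, (I.χ : ℤ) * w.im⟩ : ℂ) = w := by simp [hχ]
  simp [this, h.1, h.2]

theorem linB_of_synchronous_neg {I : Instance} (h : I.Synchronous) (hχ : I.χ = -1) (w : ℂ) :
    I.linB w = Complex.exp (I.φ * Complex.I) * (starRingEnd ℂ) w := by
  change ((I.τ * I.v : ℝ) : ℂ) * (Complex.exp (I.φ * Complex.I) * ⟨w.re, (I.χ : ℤ) * w.im⟩) = _
  have : (⟨w.re, (I.χ : ℤ) * w.im⟩ : ℂ) = (starRingEnd ℂ) w := by
    apply Complex.ext <;> simp [hχ]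
  simp [this, h.1, h.2]

/-- If the clock rates agree and `linB` fixes no nonzero vector, some point of the plane has the same
coordinates in both systems. -/
theorem exists_fixed_point_fromB {I : Instance} (hτ : I.τ = 1)
    (h : ¬ I.Synchronous ∨ (I.φ ≠ 0 ∧ I.χ = 1)) : ∃ w, I.fromB w = w := by
  have hinj : Function.Injective (LinearMap.id - I.linB : ℂ →ₗ[ℝ] ℂ) := by
    rw [← LinearMap.ker_eq_bot, LinearMap.ker_eq_bot']
    intro w hw
    rw [LinearMap.sub_apply, LinearMap.id_apply, sub_eq_zero] at hw
    -- A fixed vector is 0: for v = 1, `linB` is a rotation by an angle strictly between 0 and 2π;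
    -- otherwise it multiplies norms by v ≠ 1.
    by_cases hv : I.v = 1
    · obtain ⟨hφ, hχ⟩ := h.resolve_left (not_not.2 ⟨hτ, hv⟩)
      rw [linB_of_synchronous ⟨hτ, hv⟩ hχ] at hw
      by_contra hw0
      have h1 : Complex.exp (I.φ * Complex.I) = 1 := mul_right_cancel₀ hw0 (by rw [one_mul, ← hw])
      obtain ⟨n, hn⟩ := Complex.exp_eq_one_iff.1 h1
      have h2 : I.φ = n * (2 * Real.pi) := by
        have : (I.φ : ℂ) = n * (2 * Real.pi) := by
          apply mul_right_cancel₀ Complex.I_ne_zero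
          rw [hn]; ring
        exact_mod_cast this
      have h3 : (n : ℝ) < 1 := by
        by_contra! h4
        nlinarith [I.φ_lt, Real.pi_pos]
      have h4 : (-1 : ℝ) < n := by
        by_contra! h5
        nlinarith [I.φ_nonneg, Real.pi_pos]
      have h5 : n = 0 := by
        have h6 : n < 1 := by exact_mod_cast h3
        have h7 : -1 < n := by exact_mod_cast h4
        omega
      exact hφ (by rw [h2, h5]; simp)
    · have := I.norm_linB w
      rw [← hw, hτ, one_mul] at this
      by_contra hw0
      exact hv (mul_right_cancel₀ (norm_ne_zero_iff.2 hw0) (by rw [one_mul, ← this]))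
  obtain ⟨w, hw⟩ := LinearMap.injective_iff_surjective.1 hinj I.startB
  rw [LinearMap.sub_apply, LinearMap.id_apply] at hw
  exact ⟨w, by rw [fromB_eq, ← hw]; ring⟩

/-- Both agents have the same private coordinates at every time, so it is enough to pass near a
fixed point of the change of coordinates. -/
theorem rendezvous_of_dense {I : Instance} {p : Program} (ht : I.t = 0) (hτ : I.τ = 1)
    (h : ¬ I.Synchronous ∨ (I.φ ≠ 0 ∧ I.χ = 1)) (hp : DenseRange p.pos) : I.Rendezvous p := by
  obtain ⟨w, hw⟩ := exists_fixed_point_fromB hτ h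
  have hopen : IsOpen {z | dist z (I.fromB z) < I.r} :=
    isOpen_lt (continuous_id.dist I.continuous_fromB) continuous_const
  obtain ⟨s, hs⟩ := hp.exists_mem_open hopen ⟨w, by simpa [hw] using I.r_pos⟩
  exact rendezvous_of_local_times (a := s) (b := s) (by rw [ht, hτ]; ring) hs.le

end Instance

/-! ### Long waiting periods and different clock rates -/

theorem totalTime_block₃ (n : ℕ) :
    totalTime (block₃ n) = 2 ^ (15 * n ^ 2) + totalTime (planarCowWalk n) := by
  simp [block₃, Instr.duration]

theorem netDisplacement_block₃ (n : ℕ) : netDisplacement (block₃ n) = 0 := by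
  simp [block₃, Instr.displacement, netDisplacement_planarCowWalk]

theorem Program.Runs.pos_block₃_wait {p : Program} {T : ℝ≥0} {n : ℕ} (h : p.Runs T 0 (block₃ n))
    {s : ℝ≥0} (hs : s ≤ 2 ^ (15 * n ^ 2)) : p.pos (T + s) = 0 := by
  have := h.left s (by simpa [Instr.duration] using hs)
  rwa [walk_cons_of_le _ hs, Instr.displacement, add_zero] at this

theorem Program.Runs.pos_block₃_walk {p : Program} {T : ℝ≥0} {n : ℕ} (h : p.Runs T 0 (block₃ n))
    {s : ℝ≥0} (hs : s ≤ totalTime (planarCowWalk n)) :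
    p.pos (T + 2 ^ (15 * n ^ 2) + s) = walk (planarCowWalk n) s := by
  have := h.right s hs
  simpa [Instr.duration, Instr.displacement] using this

theorem eventually_le_two_pow (x : ℝ) : ∀ᶠ n : ℕ in atTop, x ≤ 2 ^ n :=
  (tendsto_pow_atTop_atTop_of_one_lt one_lt_two).eventually_ge_atTop x

/-- Different clock rates: the time comes when one agent explores a large square while the other one
waits at its initial position. -/
theorem Instance.rendezvous_of_block₃ {I : Instance} {p : Program} (hτ : I.τ ≠ 1) {T : ℕ → ℝ≥0}
    (hT : ∀ᶠ n in atTop, T n * 2 ^ n ≤ 2 ^ (15 * n ^ 2))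
    (hrun : ∀ᶠ n in atTop, p.Runs (T n) 0 (block₃ n)) : I.Rendezvous p := by
  have hτ0 := I.τ_pos
  have ht0 := I.t_nonneg
  have hbounds : ∀ᶠ n : ℕ in atTop, ((2 : ℝ) ^ n ≤ 2 ^ (15 * n ^ 2)) ∧
      (totalTime (planarCowWalk n) : ℝ) * 2 ^ n ≤ 2 ^ (15 * n ^ 2) := by
    filter_upwards [eventually_ge_atTop 1] with n hn
    refine ⟨pow_le_pow_right₀ one_le_two (by nlinarith), ?_⟩
    have h1 : (totalTime (planarCowWalk n) : ℝ) ≤ 2 ^ (3 * n + 6) := by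
      exact_mod_cast totalTime_planarCowWalk_le n
    calc _ ≤ (2 : ℝ) ^ (3 * n + 6) * 2 ^ n := by gcongr
      _ = 2 ^ (3 * n + 6 + n) := (pow_add _ _ _).symm
      _ ≤ _ := pow_le_pow_right₀ one_le_two (by nlinarith)
  rcases lt_or_gt_of_ne hτ with hlt | hgt
  -- B has the faster clock: it explores, looking for w, the initial position of A in its own
  -- coordinates, while A waits.
  · obtain ⟨w, hw⟩ := I.exists_fromB_eq 0
    have hU : {z | dist 0 (I.fromB z) < I.r} ∈ 𝓝 w :=
      (isOpen_lt (continuous_const.dist I.continuous_fromB) continuous_const).mem_nhds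
        (by simpa [hw] using I.r_pos)
    have hτ1 : 0 < 1 - I.τ := sub_pos.2 hlt
    obtain ⟨n, hT, hrun, ⟨hW, hP⟩, ⟨s, hs, hsU⟩, h1, h2, h3⟩ :=
      (hT.and (hrun.and (hbounds.and ((eventually_exists_walk_planarCowWalk_mem hU).and
        ((eventually_le_two_pow (1 / I.τ)).and ((eventually_le_two_pow (2 / (1 - I.τ))).and
          (eventually_le_two_pow (2 * I.t / (1 - I.τ))))))))).exists
    have hT' : (T n : ℝ) * 2 ^ n ≤ 2 ^ (15 * n ^ 2) := by exact_mod_cast hT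
    have hs' : (s : ℝ) ≤ totalTime (planarCowWalk n) := by exact_mod_cast hs
    rw [div_le_iff₀ hτ0] at h1
    rw [div_le_iff₀ hτ1] at h2 h3
    set W : ℝ := 2 ^ (15 * n ^ 2) with hWdef
    set K : ℝ := 2 ^ n
    have hlow : (T n : ℝ) ≤ I.τ * W := by
      nlinarith [mul_le_mul_of_nonneg_left hT' hτ0.le, mul_le_mul_of_nonneg_left h1 (T n).coe_nonneg]
    have e1 : 2 * I.t ≤ (1 - I.τ) * W := by nlinarith
    have e2 : 2 * (s : ℝ) ≤ (1 - I.τ) * W := by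
      nlinarith [mul_le_mul_of_nonneg_left hP hτ1.le, mul_le_mul_of_nonneg_left h2 s.coe_nonneg,
        mul_le_mul_of_nonneg_right hs' (by positivity : (0 : ℝ) ≤ K)]
    have e3 : I.τ * T n ≤ T n := mul_le_of_le_one_left (T n).coe_nonneg hlt.le
    have e4 : I.τ * s ≤ s := mul_le_of_le_one_left s.coe_nonneg hlt.le
    have e5 : 0 ≤ I.τ * T n := by positivity
    have e6 : 0 ≤ I.τ * s := by positivity
    -- How long A has been waiting when B is at time s of its cow walk. `hlow` gives x ≥ 0; `e1` and
    -- `e2` give x ≤ W.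
    obtain ⟨x, hx⟩ : ∃ x : ℝ≥0, (x : ℝ) = I.t + I.τ * (T n + W + s) - T n :=
      ⟨⟨_, by linarith⟩, rfl⟩
    refine rendezvous_of_local_times (a := T n + x) (b := T n + 2 ^ (15 * n ^ 2) + s) ?_ ?_
    · push_cast
      rw [hx, ← hWdef]
      ring
    · rw [hrun.pos_block₃_wait, hrun.pos_block₃_walk hs]
      · exact le_of_lt hsU
      · rw [← NNReal.coe_le_coe, hx]
        push_cast
        rw [← hWdef]
        linarith
  -- Roles exchanged: A explores, while B waits at its initial position and has been doing so for
  -- private time x.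
  · have hU : {z | dist z (I.fromB 0) < I.r} ∈ 𝓝 (I.fromB 0) := Metric.ball_mem_nhds _ I.r_pos
    have hτ1 : 0 < I.τ - 1 := sub_pos.2 hgt
    obtain ⟨n, hT, hrun, ⟨hW, hP⟩, ⟨s, hs, hsU⟩, h1, h2, h3⟩ :=
      (hT.and (hrun.and (hbounds.and ((eventually_exists_walk_planarCowWalk_mem hU).and
        ((eventually_le_two_pow (2 * I.τ)).and ((eventually_le_two_pow (1 / (I.τ - 1))).and
          (eventually_le_two_pow (2 * I.t)))))))).exists
    have hT' : (T n : ℝ) * 2 ^ n ≤ 2 ^ (15 * n ^ 2) := by exact_mod_cast hT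
    have hs' : (s : ℝ) ≤ totalTime (planarCowWalk n) := by exact_mod_cast hs
    rw [div_le_iff₀ hτ1] at h2
    set W : ℝ := 2 ^ (15 * n ^ 2) with hWdef
    set K : ℝ := 2 ^ n
    have e1 : 2 * (I.τ * T n) ≤ W := by
      nlinarith [mul_le_mul_of_nonneg_left h1 (T n).coe_nonneg]
    have e2 : (s : ℝ) ≤ (I.τ - 1) * W := by
      nlinarith [mul_le_mul_of_nonneg_left hP hτ1.le, mul_le_mul_of_nonneg_left h2 s.coe_nonneg,
        mul_le_mul_of_nonneg_right hs' (by positivity : (0 : ℝ) ≤ K)]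
    have e3 : (T n : ℝ) ≤ I.τ * T n := le_mul_of_one_le_left (T n).coe_nonneg hgt.le
    have e4 : (0 : ℝ) ≤ s := s.coe_nonneg
    have e5 : (0 : ℝ) ≤ T n := (T n).coe_nonneg
    obtain ⟨x, hx⟩ : ∃ x : ℝ≥0, (x : ℝ) = (T n + W + s - I.t) / I.τ - T n := by
      refine ⟨⟨_, ?_⟩, rfl⟩
      rw [sub_nonneg, le_div_iff₀ hτ0]
      linarith
    refine rendezvous_of_local_times (a := T n + 2 ^ (15 * n ^ 2) + s) (b := T n + x) ?_ ?_
    · push_cast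
      rw [hx, ← hWdef]
      field_simp
      ring
    · rw [hrun.pos_block₃_wait, hrun.pos_block₃_walk hs]
      · exact le_of_lt hsU
      · rw [← NNReal.coe_le_coe, hx]
        push_cast
        rw [← hWdef, tsub_le_iff_right, div_le_iff₀ hτ0]
        linarith

/-- Bound on the starting times of the terms of a concatenation whose growth is that of the waiting
periods of `block₃`. -/
theorem totalTime_flatMap_le {b : ℕ → List Instr}
    (hb : ∀ n, totalTime (b n) ≤ 2 ^ (15 * (n + 1) ^ 2 + 4 * (n + 1) + 9)) (n : ℕ) :
    totalTime ((List.range n).flatMap b) ≤ 2 ^ (15 * n ^ 2 + 5 * n + 9) := by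
  induction n with
  | zero => simp
  | succ n ih =>
    rw [totalTime_flatMap_range_succ]
    calc _ ≤ (2 : ℝ≥0) ^ (15 * n ^ 2 + 5 * n + 9) + 2 ^ (15 * (n + 1) ^ 2 + 4 * (n + 1) + 9) :=
          add_le_add ih (hb n)
      _ ≤ 2 ^ (15 * (n + 1) ^ 2 + 5 * n + 13) + 2 ^ (15 * (n + 1) ^ 2 + 5 * n + 13) := by
          refine add_le_add (pow_le_pow_right₀ one_le_two (by nlinarith))
            (pow_le_pow_right₀ one_le_two (by omega))
      _ = 2 ^ (15 * (n + 1) ^ 2 + 5 * (n + 1) + 9) := by ring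

theorem one_le_totalTime_block₃ (n : ℕ) : 1 ≤ totalTime (block₃ n) := by
  rw [totalTime_block₃]
  exact (one_le_pow₀ one_le_two).trans le_self_add

theorem totalTime_block₃_le (n : ℕ) : totalTime (block₃ n) ≤ 2 ^ (15 * n ^ 2 + 4 * n + 7) := by
  rw [totalTime_block₃]
  calc _ ≤ (2 : ℝ≥0) ^ (15 * n ^ 2) + 2 ^ (3 * n + 6) := by
        gcongr
        exact totalTime_planarCowWalk_le n
    _ ≤ 2 ^ (15 * n ^ 2 + 4 * n + 6) + 2 ^ (15 * n ^ 2 + 4 * n + 6) := by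
        gcongr
        · exact one_le_two
        · omega
        · exact one_le_two
        · nlinarith
    _ = 2 ^ (15 * n ^ 2 + 4 * n + 7) := by ring

/-- The blocks `block₃` alone suffice: their waits handle τ ≠ 1, and the density of their cow walks
handles τ = 1. -/
theorem exists_isCGKK : ∃ p : Program, IsCGKK p := by
  let b : ℕ → List Instr := fun n => block₃ (n + 1)
  have hb : ∀ n, 1 ≤ totalTime (b n) := fun n => one_le_totalTime_block₃ _
  have hrun : ∀ n, (Program.concat b hb).Runs (totalTime ((List.range n).flatMap b)) 0
      (block₃ (n + 1)) := fun n => by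
    have := Program.runs_concat hb n
    rwa [netDisplacement_flatMap_eq_zero fun n => netDisplacement_block₃ (n + 1)] at this
  have hrun' : ∀ᶠ n in atTop, (Program.concat b hb).Runs
      (totalTime ((List.range (n - 1)).flatMap b)) 0 (block₃ n) := by
    filter_upwards [eventually_ge_atTop 1] with n hn
    obtain ⟨m, rfl⟩ := Nat.exists_eq_add_of_le' hn
    exact hrun m
  refine ⟨Program.concat b hb, fun I ht h => ?_⟩
  by_cases hτ : I.τ = 1
  · refine Instance.rendezvous_of_dense ht hτ h fun z => ?_
    refine mem_closure_iff_nhds.2 fun U hU => ?_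
    obtain ⟨n, hn, s, hs, hsU⟩ :=
      (hrun'.and (eventually_exists_walk_planarCowWalk_mem hU)).exists
    exact ⟨_, hsU, _, hn.pos_block₃_walk hs⟩
  · refine Instance.rendezvous_of_block₃ hτ ?_ hrun'
    filter_upwards [eventually_ge_atTop 1] with n hn
    obtain ⟨m, rfl⟩ := Nat.exists_eq_add_of_le' hn
    calc _ ≤ (2 : ℝ≥0) ^ (15 * m ^ 2 + 5 * m + 9) * 2 ^ (m + 1) := by
          gcongr
          refine totalTime_flatMap_le (fun n => (totalTime_block₃_le _).trans ?_) m
          exact pow_le_pow_right₀ one_le_two (by omega)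
      _ = 2 ^ (15 * m ^ 2 + 5 * m + 9 + (m + 1)) := (pow_add _ _ _).symm
      _ ≤ _ := pow_le_pow_right₀ one_le_two (by nlinarith)

/-! ### Existence of a `Latecomers` procedure -/

/-- Splitting of the delay `t`: an agent that goes straight ahead until time `D` and then comes back is, at
time `D + u`, ahead by `w - u` of its position at time `D - w = D + u - t`. -/
theorem exists_delay_split {t d r : ℝ} (ht : 0 ≤ t) (hr : 0 < r) (h : |d| - r < t) :
    ∃ u w : ℝ≥0, (u + w : ℝ) = t ∧ |(w - u : ℝ) - d| < r := by
  have h1 := le_abs_self d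
  have h2 := neg_abs_le d
  -- σ = w - u is the point of [-t, t] nearest to d.
  obtain ⟨σ, h3, h4, h5⟩ : ∃ σ, -t ≤ σ ∧ σ ≤ t ∧ |σ - d| < r := by
    rcases le_total d t with h3 | h3
    · rcases le_total (-t) d with h4 | h4
      · exact ⟨d, h4, h3, by simpa using hr⟩
      · exact ⟨-t, le_rfl, by linarith, by rw [abs_lt]; constructor <;> linarith⟩
    · exact ⟨t, by linarith, le_rfl, by rw [abs_lt]; constructor <;> linarith⟩
  refine ⟨⟨(t - σ) / 2, by linarith⟩, ⟨(t + σ) / 2, by linarith⟩, ?_, ?_⟩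
  · change (t - σ) / 2 + (t + σ) / 2 = t
    ring
  · change |(t + σ) / 2 - (t - σ) / 2 - d| < r
    convert h5 using 2
    ring

/-- Going straight towards B's start and returning, A meets the late B on its way out. Countably
many directions suffice because the sight condition is open in the angle. -/
theorem exists_isLatecomers : ∃ p : Program, IsLatecomers p := by
  obtain ⟨f, hf⟩ := exists_surjective_nat (ℚ × ℕ)
  let b : ℕ → List Instr := fun n =>
    [.go (f n).1 ((f n).2 + 1), .go ((f n).1 + Real.pi) ((f n).2 + 1)]
  have hb : ∀ n, 1 ≤ totalTime (b n) := fun n => by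
    simp only [b, totalTime_cons, Instr.duration, add_assoc]
    exact le_add_left le_self_add
  have hnet : ∀ n, netDisplacement (b n) = 0 := fun n => by
    simp [b, Instr.displacement_reverse, Instr.duration]
  refine ⟨Program.concat b hb, fun I hI hφ hχ ht => ?_⟩
  obtain ⟨u, w, huw, hd⟩ := exists_delay_split (d := ‖I.startB‖) I.t_nonneg I.r_pos
    (by simpa [Instance.startA] using ht)
  have hopen : IsOpen {θ : ℝ |
      ‖Complex.exp (θ * Complex.I) * (w - u : ℝ) - I.startB‖ < I.r} :=
    isOpen_lt (by fun_prop) continuous_const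
  obtain ⟨q, hq⟩ := Rat.denseRange_cast.exists_mem_open hopen ⟨Complex.arg I.startB, by
    have h1 : Complex.exp (I.startB.arg * Complex.I) * (w - u : ℝ) - I.startB
        = Complex.exp (I.startB.arg * Complex.I) * ((w - u - ‖I.startB‖ : ℝ) : ℂ) := by
      nth_rewrite 2 [← Complex.norm_mul_exp_arg_mul_I I.startB]
      push_cast
      ring
    rw [Set.mem_ofPred_eq, h1, norm_mul, Complex.norm_exp_ofReal_mul_I, one_mul, Complex.norm_real]
    exact hd⟩
  obtain ⟨m, hm⟩ := exists_nat_ge I.t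
  obtain ⟨n, hn⟩ := hf (q, m)
  have hrun := Program.runs_concat hb n
  rw [netDisplacement_flatMap_eq_zero hnet] at hrun
  have hbn : b n = [.go q (m + 1), .go (q + Real.pi) (m + 1)] := by simp only [b, hn]
  rw [hbn] at hrun
  have hu : u ≤ m + 1 := by
    rw [← NNReal.coe_le_coe]
    push_cast
    linarith [w.coe_nonneg]
  have hw : w ≤ m + 1 := by
    rw [← NNReal.coe_le_coe]
    push_cast
    linarith [u.coe_nonneg]
  -- A is u into its return, B still w before its turning point; these moments coincide because u +
  -- w = t.
  have hA := hrun (m + 1 + u) (by simpa [Instr.duration] using hu)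
  have hB := hrun (m + 1 - w) (by simp [Instr.duration, add_assoc])
  have hAw := walk_pair_right (a := .go (q : ℝ) (m + 1)) (b := .go (q + Real.pi) (m + 1)) (s := u) hu
  have hBw := walk_pair_left (a := .go (q : ℝ) (m + 1)) (b := .go (q + Real.pi) (m + 1))
    (s := m + 1 - w) tsub_le_self
  rw [Instr.displacement_reverse] at hAw
  simp only [Instr.duration] at hAw
  rw [hAw, zero_add] at hA
  rw [hBw, zero_add] at hB
  refine Instance.rendezvous_of_local_times (a := totalTime ((List.range n).flatMap b) + (m + 1 + u))
    (b := totalTime ((List.range n).flatMap b) + (m + 1 - w)) ?_ ?_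
  rotate_left
  · replace hq : ‖Complex.exp (((q : ℝ) : ℂ) * Complex.I) * (w - u : ℝ) - I.startB‖ < I.r := hq
    rw [hA, hB, Instance.fromB_eq, Instance.linB_of_synchronous hI hχ, hφ, dist_eq_norm]
    refine (le_of_eq (congrArg norm ?_)).trans hq.le
    simp only [Instr.displacement]
    rw [NNReal.coe_sub hw]
    push_cast
    simp
    ring
  · rw [← huw, hI.1]
    push_cast
    rw [NNReal.coe_sub hw]
    push_cast
    ring

/-! ### The four blocks of a phase -/

theorem netDisplacement_block₁ (i : ℕ) : netDisplacement (block₁ i) = 0 :=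
  netDisplacement_flatMap_eq_zero
    (fun k => by rw [netDisplacement_rotate, netDisplacement_planarCowWalk, mul_zero]) _

theorem totalTime_block₁_le (i : ℕ) : totalTime (block₁ i) ≤ 2 ^ (4 * i + 7) := by
  rw [block₁, totalTime_flatMap_range_const _ fun k _ => totalTime_rotate _ _]
  calc _ ≤ ((2 ^ (i + 1) : ℕ) : ℝ≥0) * 2 ^ (3 * i + 6) := by
        gcongr
        exact totalTime_planarCowWalk_le i
    _ = 2 ^ (4 * i + 7) := by push_cast; ring

theorem netDisplacement_block₂ (p : Program) (i : ℕ) : netDisplacement (block₂ p i) = 0 := by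
  simp [block₂, netDisplacement_backtrack, Instr.displacement]

theorem totalTime_block₂_le (p : Program) (i : ℕ) : totalTime (block₂ p i) ≤ 2 ^ (i + 2) := by
  have h := totalTime_backtrack_le (p.during (2 ^ i))
  rw [p.totalTime_during] at h
  simp only [block₂, totalTime_append, p.totalTime_during, totalTime_cons, Instr.duration,
    totalTime_nil]
  calc _ ≤ (2 : ℝ≥0) ^ i + 0 + 2 ^ i + 2 ^ i := by gcongr
    _ ≤ 2 ^ i + 0 + 2 ^ i + 2 ^ i + 2 ^ i := le_self_add
    _ = 2 ^ (i + 2) := by ring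

theorem netDisplacement_segment (p : Program) {i j : ℕ} (hj : j < 2 ^ (2 * i)) :
    netDisplacement (segment p i j) = p.pos ((j + 1 : ℕ) / 2 ^ i) - p.pos (j / 2 ^ i) := by
  have h : ((j + 1 : ℕ) / 2 ^ i : ℝ≥0) ≤ 2 ^ i := by
    rw [div_le_iff₀ (by positivity), ← pow_add, ← two_mul]
    exact_mod_cast hj
  have h' : (j / 2 ^ i : ℝ≥0) ≤ (j + 1 : ℕ) / 2 ^ i := by
    gcongr
    simp
  rw [segment, netDisplacement_takeTime, walk_dropTime, ← add_div, ← Nat.cast_succ,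
    p.walk_during h, p.walk_during (h'.trans h)]

/-- Telescoping; the inserted waits contribute nothing. -/
theorem netDisplacement_segments (p : Program) {i k : ℕ} (hk : k ≤ 2 ^ (2 * i)) :
    netDisplacement ((List.range k).flatMap fun j => segment p i j ++ [.wait (2 ^ i)])
      = p.pos (k / 2 ^ i) := by
  induction k with
  | zero => simp [Program.pos]
  | succ k ih =>
    rw [netDisplacement_flatMap_range_succ, ih (by omega), netDisplacement_append,
      netDisplacement_segment p (by omega)]
    simp [Instr.displacement]

theorem totalTime_segmentedCGKK_le (p : Program) (i : ℕ) :
    totalTime (segmentedCGKK p i) ≤ 2 ^ (3 * i + 1) := by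
  have hseg : ∀ k, totalTime ((List.range k).flatMap fun j => segment p i j ++ [.wait (2 ^ i)])
      ≤ k * 2 ^ (i + 1) := by
    intro k
    induction k with
    | zero => simp
    | succ k ih =>
      have h1 : totalTime (segment p i k) ≤ 2 ^ i := by
        rw [segment, totalTime_takeTime]
        exact (min_le_left _ _).trans
          ((div_le_self zero_le (one_le_pow₀ one_le_two)).trans (one_le_pow₀ one_le_two))
      rw [totalTime_flatMap_range_succ]
      calc _ ≤ (k : ℝ≥0) * 2 ^ (i + 1) + (2 ^ i + 2 ^ i) := by
            refine add_le_add ih ?_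
            simpa [Instr.duration] using h1
        _ = _ := by push_cast; ring
  calc _ ≤ ((2 ^ (2 * i) : ℕ) : ℝ≥0) * 2 ^ (i + 1) := hseg _
    _ = 2 ^ (3 * i + 1) := by push_cast; ring

theorem netDisplacement_block₄ (p : Program) (i : ℕ) : netDisplacement (block₄ p i) = 0 := by
  simp [block₄, netDisplacement_backtrack]

theorem totalTime_block₄_le (p : Program) (i : ℕ) : totalTime (block₄ p i) ≤ 2 ^ (3 * i + 2) := by
  rw [block₄, totalTime_append]
  calc _ ≤ totalTime (segmentedCGKK p i) + totalTime (segmentedCGKK p i) :=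
        add_le_add_right (totalTime_backtrack_le _) _
    _ ≤ (2 : ℝ≥0) ^ (3 * i + 1) + 2 ^ (3 * i + 1) :=
        add_le_add (totalTime_segmentedCGKK_le p i) (totalTime_segmentedCGKK_le p i)
    _ = 2 ^ (3 * i + 2) := by ring

theorem netDisplacement_phase (cgkk latecomers : Program) (i : ℕ) :
    netDisplacement (phase cgkk latecomers i) = 0 := by
  simp [phase, netDisplacement_block₁, netDisplacement_block₂, netDisplacement_block₃,
    netDisplacement_block₄]

/-- Each of the four blocks is bounded by the bound for `block₃`, whose wait dominates. -/
theorem totalTime_phase_le (cgkk latecomers : Program) (i : ℕ) :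
    totalTime (phase cgkk latecomers i) ≤ 2 ^ (15 * i ^ 2 + 4 * i + 9) := by
  simp only [phase, totalTime_append]
  have h : ∀ k ≤ 15 * i ^ 2 + 4 * i + 7, (2 : ℝ≥0) ^ k ≤ 2 ^ (15 * i ^ 2 + 4 * i + 7) :=
    fun k hk => pow_le_pow_right₀ one_le_two hk
  calc _ ≤ (2 : ℝ≥0) ^ (15 * i ^ 2 + 4 * i + 7) + 2 ^ (15 * i ^ 2 + 4 * i + 7)
        + 2 ^ (15 * i ^ 2 + 4 * i + 7) + 2 ^ (15 * i ^ 2 + 4 * i + 7) := by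
        refine add_le_add (add_le_add (add_le_add ?_ ?_) ?_) ?_
        · exact (totalTime_block₁_le i).trans (h _ (by nlinarith))
        · exact (totalTime_block₂_le latecomers i).trans (h _ (by nlinarith))
        · exact totalTime_block₃_le i
        · exact (totalTime_block₄_le cgkk i).trans (h _ (by nlinarith))
    _ = 2 ^ (15 * i ^ 2 + 4 * i + 9) := by ring

/-! ### Rendezvous in each class of instances -/

namespace Instance

/-- Same clock rates: if the segments of `CGKK` are separated by waiting periods longer than the delay,
both agents wait at the ends of the same segments. -/
theorem rendezvous_of_block₄ {I : Instance} {p cgkk : Program} (hcgkk : IsCGKK cgkk)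
    (hτ : I.τ = 1) (h : ¬ I.Synchronous ∨ (I.φ ≠ 0 ∧ I.χ = 1))
    (hrun : ∀ᶠ n in atTop, ∃ T, p.Runs T 0 (block₄ cgkk n)) : I.Rendezvous p := by
  -- Halving the radius leaves room to perturb the meeting time; the change of coordinates `fromB`
  -- does not depend on r or t.
  let J : Instance := { I with r := I.r / 2, t := 0, r_pos := half_pos I.r_pos, t_nonneg := le_rfl }
  obtain ⟨s, hs⟩ := (J.rendezvous_iff cgkk).1 (hcgkk J rfl h)
  have hsB : Real.toNNReal (((s : ℝ) - J.t) / J.τ) = s := by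
    change Real.toNNReal (((s : ℝ) - 0) / I.τ) = s
    rw [hτ, sub_zero, div_one, Real.toNNReal_coe]
  rw [soloB, hsB] at hs
  replace hs : dist (cgkk.pos s) (I.fromB (cgkk.pos s)) ≤ I.r / 2 := hs
  have hU : {s | dist (cgkk.pos s) (I.fromB (cgkk.pos s)) < I.r} ∈ 𝓝 s :=
    (isOpen_lt (cgkk.continuous_pos.dist (I.continuous_fromB.comp cgkk.continuous_pos))
      continuous_const).mem_nhds (hs.trans_lt (half_lt_self I.r_pos))
  -- The end of the segment during which s falls; adding 1 ensures that at least one segment, hence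
  -- a waiting period, precedes it.
  have hlim : Tendsto (fun n : ℕ => ((⌊(s : ℝ) * 2 ^ n⌋₊ + 1 : ℕ) / 2 ^ n : ℝ≥0)) atTop (𝓝 s) := by
    rw [← NNReal.tendsto_coe]
    have h2 : Tendsto (fun n : ℕ => (2 : ℝ) ^ n) atTop atTop :=
      tendsto_pow_atTop_atTop_of_one_lt one_lt_two
    have h3 := ((tendsto_nat_floor_mul_div_atTop s.coe_nonneg).comp h2).add
      (tendsto_inv_atTop_zero.comp h2)
    rw [add_zero] at h3
    refine h3.congr fun n => ?_
    simp only [Function.comp_apply]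
    push_cast
    rw [add_div, one_div]
  obtain ⟨n, ⟨T, hT⟩, hn, hsn, htn⟩ := (hrun.and ((hlim.eventually_mem hU).and
    ((eventually_le_two_pow (s + 1)).and (eventually_le_two_pow I.t)))).exists
  have hk : ⌊(s : ℝ) * 2 ^ n⌋₊ + 1 ≤ 2 ^ (2 * n) := by
    have h1 : (⌊(s : ℝ) * 2 ^ n⌋₊ : ℝ) ≤ s * 2 ^ n := Nat.floor_le (by positivity)
    have : (⌊(s : ℝ) * 2 ^ n⌋₊ + 1 : ℝ) ≤ 2 ^ (2 * n) := by
      calc _ ≤ (s : ℝ) * 2 ^ n + 2 ^ n := add_le_add h1 (one_le_pow₀ one_le_two)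
        _ = (s + 1) * 2 ^ n := by ring
        _ ≤ 2 ^ n * 2 ^ n := by gcongr
        _ = 2 ^ (2 * n) := by ring
    exact_mod_cast this
  obtain ⟨l, hl⟩ := flatMap_range_split (fun j => segment cgkk n j ++ [.wait (2 ^ n)])
    (Nat.lt_of_succ_le hk)
  have hnet := netDisplacement_segments cgkk hk
  generalize ⌊(s : ℝ) * 2 ^ n⌋₊ = k at *
  rw [netDisplacement_flatMap_range_succ, netDisplacement_append] at hnet
  have hwait := (hT.left : p.Runs T 0 (segmentedCGKK cgkk n))
  rw [segmentedCGKK, hl, ← List.append_assoc] at hwait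
  replace hwait := hwait.left.right
  have hpos : ∀ x ≤ (2 : ℝ≥0) ^ n, p.pos (T + totalTime
      ((List.range k).flatMap (fun j => segment cgkk n j ++ [.wait (2 ^ n)])
        ++ segment cgkk n k) + x) = cgkk.pos ((k + 1 : ℕ) / 2 ^ n) := by
    intro x hx
    rw [hwait x (by simpa [Instr.duration] using hx), ← hnet, walk_cons_of_le _ hx]
    simp [Instr.displacement]
  -- When A ends this waiting period, B has been in the same one for time 2^n - t.
  obtain ⟨x, hx⟩ : ∃ x : ℝ≥0, (x : ℝ) = 2 ^ n - I.t := ⟨⟨_, sub_nonneg.2 htn⟩, rfl⟩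
  have hxn : x ≤ 2 ^ n := by
    rw [← NNReal.coe_le_coe, hx]
    push_cast
    linarith [I.t_nonneg]
  refine rendezvous_of_local_times ?_ (a := _ + 2 ^ n) (b := _ + x)
    (by rw [hpos _ le_rfl, hpos x hxn]; exact le_of_lt hn)
  rw [hτ]
  push_cast
  rw [hx]
  ring

/-- Synchronous agents whose systems are shifts of each other: the waiting period before the execution
of `Latecomers` reproduces the delay. -/
theorem rendezvous_of_block₂ {I : Instance} {p latecomers : Program}
    (hlate : IsLatecomers latecomers) (hI : I.Synchronous) (hφ : I.φ = 0) (hχ : I.χ = 1)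
    (ht : dist startA I.startB - I.r < I.t)
    (hrun : ∀ᶠ n in atTop, ∃ T, p.Runs T 0 (block₂ latecomers n)) : I.Rendezvous p := by
  obtain ⟨s, hs⟩ := (I.rendezvous_iff latecomers).1 (hlate I hI hφ hχ ht)
  obtain ⟨n, ⟨T, hT⟩, hsn, htn⟩ := (hrun.and ((eventually_le_two_pow s).and
    (eventually_le_two_pow I.t))).exists
  replace hsn : s ≤ 2 ^ n := by exact_mod_cast hsn
  rw [block₂, List.append_assoc] at hT
  have hwait : ∀ x ≤ (2 : ℝ≥0) ^ n, p.pos (T + x) = 0 := by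
    intro x hx
    rw [hT.left x (by simpa [Instr.duration] using hx), walk_cons_of_le _ hx]
    simp [Instr.displacement]
  have hmove : ∀ x ≤ (2 : ℝ≥0) ^ n, p.pos (T + 2 ^ n + x) = latecomers.pos x := by
    intro x hx
    have := hT.right.left x (by rwa [latecomers.totalTime_during])
    rw [latecomers.walk_during hx] at this
    simpa [Instr.duration, Instr.displacement] using this
  rw [soloB, hI.1, div_one] at hs
  rcases le_total I.t s with h | h
  · refine rendezvous_of_local_times (a := T + 2 ^ n + s)
      (b := T + 2 ^ n + Real.toNNReal (s - I.t)) ?_ ?_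
    · push_cast
      rw [Real.coe_toNNReal _ (sub_nonneg.2 h), hI.1]
      ring
    · rw [hmove s hsn, hmove]
      · exact hs
      · refine (Real.toNNReal_le_toNNReal (sub_le_self _ I.t_nonneg)).trans ?_
        rwa [Real.toNNReal_coe]
  · obtain ⟨x, hx⟩ : ∃ x : ℝ≥0, (x : ℝ) = 2 ^ n + s - I.t :=
      ⟨⟨_, by linarith [s.coe_nonneg]⟩, rfl⟩
    refine rendezvous_of_local_times (a := T + 2 ^ n + s) (b := T + x) ?_ ?_
    · push_cast
      rw [hx, hI.1]
      ring
    · rw [hmove s hsn, hwait]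
      · rw [Real.toNNReal_of_nonpos (by linarith)] at hs
        have h0 : latecomers.pos 0 = 0 := walk_zero _
        rwa [h0] at hs
      · rw [← NNReal.coe_le_coe, hx]
        push_cast
        linarith

/-- The distance between the projections is measured along the canonical line. -/
theorem dist_proj (I : Instance) :
    dist I.projA I.projB
      = |((starRingEnd ℂ) (Complex.exp ((I.φ / 2 : ℝ) * Complex.I)) * I.startB).re| := by
  set e := Complex.exp ((I.φ / 2 : ℝ) * Complex.I) with he
  have hdir : I.canonicalLine.direction = Submodule.span ℝ {e} :=
    AffineSubspace.direction_mk' _ _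
  have hmem : I.projB - I.projA ∈ Submodule.span ℝ {e} := by
    rw [← hdir]
    exact AffineSubspace.vsub_mem_direction
      (EuclideanGeometry.orthogonalProjection_mem _) (EuclideanGeometry.orthogonalProjection_mem _)
  obtain ⟨c, hc⟩ := Submodule.mem_span_singleton.1 hmem
  -- Projecting keeps the e-component, so c is the e-component of `startB`; the base point of the
  -- line plays no role.
  have horth : ∀ z : ℂ, inner ℝ e
      (z - (EuclideanGeometry.orthogonalProjection I.canonicalLine z : ℂ)) = 0 := by
    intro z
    have := EuclideanGeometry.vsub_orthogonalProjection_mem_direction_orthogonal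
      I.canonicalLine z
    exact (Submodule.mem_orthogonal _ _).1 this e (hdir ▸ Submodule.mem_span_singleton_self e)
  have hA : inner ℝ e I.projA = 0 := by
    have := horth startA
    rw [inner_sub_right, startA, inner_zero_right, zero_sub, neg_eq_zero] at this
    exact this
  have hB : inner ℝ e I.startB = inner ℝ e I.projB := by
    have := horth I.startB
    rwa [inner_sub_right, sub_eq_zero] at this
  have hnorm : ‖e‖ = 1 := Complex.norm_exp_ofReal_mul_I _
  have hinner : inner ℝ e I.startB = c := by
    rw [hB, ← sub_zero (inner ℝ e I.projB), ← hA, ← inner_sub_right, ← hc, inner_smul_right,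
      real_inner_self_eq_norm_sq, hnorm]
    ring
  rw [Complex.inner] at hinner
  rw [mul_comm, hinner, dist_comm, dist_eq_norm, ← hc, norm_smul, hnorm, mul_one, Real.norm_eq_abs]

/-- Synchronous agents with opposite chiralities: when the walks are almost parallel to the canonical
line and the agents are close to it, they follow each other. -/
theorem rendezvous_of_block₁ {I : Instance} {p : Program} (hI : I.Synchronous) (hχ : I.χ = -1)
    (ht : dist I.projA I.projB - I.r < I.t)
    (hrun : ∀ᶠ n in atTop, ∃ T, p.Runs T 0 (block₁ n)) : I.Rendezvous p := by
  rw [dist_proj] at ht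
  -- B's start in the frame turned by φ/2: `z.re` is measured along the canonical line, which lies
  -- at height `z.im / 2`.
  set z := (starRingEnd ℂ) (Complex.exp ((I.φ / 2 : ℝ) * Complex.I)) * I.startB with hz
  obtain ⟨u, w, huw, hd⟩ := exists_delay_split I.t_nonneg I.r_pos ht
  obtain ⟨j, hj⟩ := pow_unbounded_of_one_lt I.t one_lt_two
  replace hj : I.t ≤ 2 ^ (j + 1) := hj.le.trans (pow_le_pow_right₀ one_le_two (by omega))
  have hu : u ≤ 2 ^ (j + 1) := by
    rw [← NNReal.coe_le_coe]
    push_cast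
    linarith [w.coe_nonneg]
  have hw : w ≤ 2 ^ (j + 1) := by
    rw [← NNReal.coe_le_coe]
    push_cast
    linarith [u.coe_nonneg]
  -- In a walk rotated by α, at height κ: the point at distance x from the east end, passed x before
  -- and again x after the turn.
  let posAt : ℝ → ℝ → ℝ≥0 → ℂ := fun α κ x =>
    Complex.exp (α * Complex.I) * (κ * Complex.I + ((2 ^ (j + 1) - x : ℝ) : ℂ))
  have hcont : ∀ x, Continuous fun q : ℝ × ℝ => posAt q.1 q.2 x := fun x => by fun_prop
  have hU : {q : ℝ × ℝ | dist (posAt q.1 q.2 u) (I.fromB (posAt q.1 q.2 w)) < I.r}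
      ∈ 𝓝 (I.φ / 2, z.im / 2) := by
    refine (isOpen_lt ((hcont u).dist (I.continuous_fromB.comp (hcont w)))
      continuous_const).mem_nhds ?_
    have hconj : (starRingEnd ℂ) (Complex.exp ((I.φ / 2 : ℝ) * Complex.I))
        = Complex.exp (-((I.φ / 2 : ℝ) * Complex.I)) := by
      rw [← Complex.exp_conj, map_mul, Complex.conj_ofReal, Complex.conj_I, mul_neg]
    have hB : I.startB = Complex.exp ((I.φ / 2 : ℝ) * Complex.I) * z := by
      rw [hz, hconj, ← mul_assoc, ← Complex.exp_add, add_neg_cancel, Complex.exp_zero, one_mul]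
    have hφ : Complex.exp (I.φ * Complex.I)
        = Complex.exp ((I.φ / 2 : ℝ) * Complex.I) * Complex.exp ((I.φ / 2 : ℝ) * Complex.I) := by
      rw [← Complex.exp_add]
      congr 1
      push_cast
      ring
    -- In the turned frame B's map is q ↦ z + conj q, which preserves the line of height `z.im / 2`;
    -- only a gap along this line remains.
    have hdiff : posAt (I.φ / 2) (z.im / 2) u - I.fromB (posAt (I.φ / 2) (z.im / 2) w)
        = Complex.exp ((I.φ / 2 : ℝ) * Complex.I) * ((w - u - z.re : ℝ) : ℂ) := by
      have hunit : Complex.exp ((I.φ / 2 : ℝ) * Complex.I)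
          * Complex.exp (-((I.φ / 2 : ℝ) * Complex.I)) = 1 := by
        rw [← Complex.exp_add, add_neg_cancel, Complex.exp_zero]
      rw [fromB_eq, linB_of_synchronous_neg hI hχ, map_mul, hconj, hφ, hB, map_add, map_mul,
        Complex.conj_ofReal, Complex.conj_I, Complex.conj_ofReal]
      simp only [posAt]
      generalize Complex.exp ((I.φ / 2 : ℝ) * Complex.I) = E at hunit ⊢
      generalize Complex.exp (-((I.φ / 2 : ℝ) * Complex.I)) = E' at hunit ⊢
      have hre := Complex.re_add_im z
      push_cast
      linear_combination (-E * (-(z.im / 2 * Complex.I) + (2 ^ (j + 1) - w))) * hunit + E * hre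
    change dist (posAt (I.φ / 2) (z.im / 2) u) (I.fromB (posAt (I.φ / 2) (z.im / 2) w)) < I.r
    rw [dist_eq_norm, hdiff, norm_mul, Complex.norm_exp_ofReal_mul_I, one_mul, Complex.norm_real]
    exact hd
  have hψ : 0 ≤ I.φ / 2 / Real.pi := 
    div_nonneg (div_nonneg I.φ_nonneg two_pos.le) Real.pi_pos.le
  have hψ1 : I.φ / 2 / Real.pi ≤ 1 := by
    rw [div_le_one Real.pi_pos]
    linarith [I.φ_lt]
  have hα : Tendsto (fun n : ℕ =>
      ((⌊I.φ / 2 / Real.pi * 2 ^ n⌋₊ + 1 : ℕ) : ℝ) * Real.pi / 2 ^ n) atTop (𝓝 (I.φ / 2)) := by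
    have h2 : Tendsto (fun n : ℕ => (2 : ℝ) ^ n) atTop atTop :=
      tendsto_pow_atTop_atTop_of_one_lt one_lt_two
    have h3 := (((tendsto_nat_floor_mul_div_atTop hψ).comp h2).add
      (tendsto_inv_atTop_zero.comp h2)).mul_const Real.pi
    rw [add_zero, div_mul_cancel₀ _ Real.pi_ne_zero] at h3
    refine h3.congr fun n => ?_
    simp only [Function.comp_apply]
    push_cast
    ring
  obtain ⟨n, ⟨T, hT⟩, hn, hk, hjn⟩ := (hrun.and
    (((hα.prodMk_nhds (tendsto_floor_mul_two_pow_div (z.im / 2))).eventually_mem hU).and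
      ((eventually_abs_floor_mul_two_pow_le (z.im / 2)).and (eventually_gt_atTop j)))).exists
  replace hn : dist (posAt _ _ u) (I.fromB (posAt _ _ w)) < I.r := hn
  -- The rotations are numbered from 1, hence floor plus one in the angle; φ/2 < π keeps the number
  -- in range.
  have hfloor : ⌊I.φ / 2 / Real.pi * 2 ^ n⌋₊ < 2 ^ (n + 1) := by
    rw [Nat.floor_lt (by positivity)]
    push_cast
    rw [pow_succ]
    nlinarith [pow_pos (two_pos : (0 : ℝ) < 2) n]
  obtain ⟨l, hl⟩ := flatMap_range_split (fun k => (planarCowWalk n).map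
    (Instr.rotate (((k + 1 : ℕ) : ℝ) * Real.pi / 2 ^ n))) hfloor
  obtain ⟨l₁, l₂, hplan, hnet⟩ := planarCowWalk_split hjn hk
  rw [block₁, hl, List.append_assoc] at hT
  replace hT := hT.right.left
  rw [netDisplacement_flatMap_eq_zero
    (fun k => by rw [netDisplacement_rotate, netDisplacement_planarCowWalk, mul_zero])] at hT
  generalize ((⌊I.φ / 2 / Real.pi * 2 ^ n⌋₊ + 1 : ℕ) : ℝ) * Real.pi / 2 ^ n = α at *
  rw [hplan, List.map_append, List.map_append] at hT
  replace hT := hT.left.right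
  rw [netDisplacement_rotate, hnet, add_zero, zero_add, totalTime_rotate] at hT
  generalize T + totalTime _ + totalTime l₁ = T' at hT
  have hposA : p.pos (T' + (2 ^ (j + 1) + u)) = posAt α (⌊z.im / 2 * 2 ^ n⌋ / 2 ^ n) u := by
    have hu' : u ≤ 2 ^ (j + 2) := hu.trans (pow_le_pow_right₀ one_le_two (by omega))
    have := walk_pair_right (a := goE (2 ^ (j + 1))) (b := goW (2 ^ (j + 2))) hu'
    rw [duration_goE, displacement_goE, displacement_goW] at this
    rw [hT _ (by rw [totalTime_rotate]; simpa using hu'), walk_rotate, this]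
    simp only [posAt]
    push_cast
    ring
  have hposB : p.pos (T' + (2 ^ (j + 1) - w)) = posAt α (⌊z.im / 2 * 2 ^ n⌋ / 2 ^ n) w := by
    rw [hT _ (by rw [totalTime_rotate]; simp [add_assoc]), walk_rotate,
      walk_pair_left (by simp), displacement_goE, NNReal.coe_sub hw]
    simp only [posAt]
    push_cast
    ring
  refine rendezvous_of_local_times (a := T' + (2 ^ (j + 1) + u)) (b := T' + (2 ^ (j + 1) - w)) ?_
    (by rw [hposA, hposB]; exact hn.le)
  rw [← huw, hI.1]
  push_cast
  rw [NNReal.coe_sub hw]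
  push_cast
  ring

theorem rendezvous_almostUniversalRV {cgkk latecomers : Program} (hcgkk : IsCGKK cgkk)
    (hlate : IsLatecomers latecomers) {I : Instance}
    (h : ¬ I.Synchronous ∨ (I.χ = 1 ∧ I.φ ≠ 0) ∨
      (I.χ = 1 ∧ I.φ = 0 ∧ dist startA I.startB - I.r < I.t) ∨
      (I.χ = -1 ∧ dist I.projA I.projB - I.r < I.t)) :
    I.Rendezvous (almostUniversalRV cgkk latecomers) := by
  let start : ℕ → ℝ≥0 := fun n =>
    totalTime ((List.range (n - 1)).flatMap fun k => phase cgkk latecomers (k + 1))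
  have hphase : ∀ᶠ n in atTop, (almostUniversalRV cgkk latecomers).Runs (start n) 0
      (block₁ n ++ block₂ latecomers n ++ block₃ n ++ block₄ cgkk n) := by
    filter_upwards [eventually_ge_atTop 1] with n hn
    obtain ⟨m, rfl⟩ := Nat.exists_eq_add_of_le' hn
    have := Program.runs_concat (fun k => one_le_totalTime_phase cgkk latecomers (k + 1)) m
    rwa [netDisplacement_flatMap_eq_zero fun k => netDisplacement_phase _ _ (k + 1)] at this
  have hrun₁ : ∀ᶠ n in atTop, ∃ T, (almostUniversalRV cgkk latecomers).Runs T 0 (block₁ n) :=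
    hphase.mono fun n hn => ⟨_, hn.left.left.left⟩
  have hrun₂ : ∀ᶠ n in atTop,
      ∃ T, (almostUniversalRV cgkk latecomers).Runs T 0 (block₂ latecomers n) := by
    filter_upwards [hphase] with n hn
    have := hn.left.left.right
    rw [netDisplacement_block₁, add_zero] at this
    exact ⟨_, this⟩
  have hrun₃ : ∀ᶠ n in atTop, (almostUniversalRV cgkk latecomers).Runs
      (start n + totalTime (block₁ n ++ block₂ latecomers n)) 0 (block₃ n) := by
    filter_upwards [hphase] with n hn
    have := hn.left.right
    rwa [netDisplacement_append, netDisplacement_block₁, netDisplacement_block₂, add_zero,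
      add_zero] at this
  have hrun₄ : ∀ᶠ n in atTop,
      ∃ T, (almostUniversalRV cgkk latecomers).Runs T 0 (block₄ cgkk n) := by
    filter_upwards [hphase] with n hn
    have := hn.right
    rw [netDisplacement_append, netDisplacement_append, netDisplacement_block₁,
      netDisplacement_block₂, netDisplacement_block₃, add_zero, add_zero, add_zero] at this
    exact ⟨_, this⟩
  -- The clock rates are compared first: once they agree, the remaining non-synchronous instances
  -- have v ≠ 1 and fall to `block₄`.
  by_cases hτ : I.τ = 1
  swap
  · refine rendezvous_of_block₃ hτ ?_ hrun₃
    filter_upwards [eventually_ge_atTop 1] with n hn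
    obtain ⟨m, rfl⟩ := Nat.exists_eq_add_of_le' hn
    -- The constant 11 comes from `block₁`, bounded by 2^(4(m + 1) + 7). A fourth, superfluous
    -- summand below makes the sum a power of 2.
    have hpow : ∀ k ≤ 15 * m ^ 2 + 5 * m + 11, (2 : ℝ≥0) ^ k ≤ 2 ^ (15 * m ^ 2 + 5 * m + 11) :=
      fun k hk => pow_le_pow_right₀ one_le_two hk
    have h0 : start (m + 1) ≤ 2 ^ (15 * m ^ 2 + 5 * m + 11) :=
      (totalTime_flatMap_le (fun n => totalTime_phase_le _ _ _) m).trans (hpow _ (by omega))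
    have h1 : totalTime (block₁ (m + 1)) ≤ 2 ^ (15 * m ^ 2 + 5 * m + 11) :=
      (totalTime_block₁_le _).trans (hpow _ (by omega))
    have h2 : totalTime (block₂ latecomers (m + 1)) ≤ 2 ^ (15 * m ^ 2 + 5 * m + 11) :=
      (totalTime_block₂_le _ _).trans (hpow _ (by omega))
    rw [totalTime_append]
    calc _ ≤ ((2 : ℝ≥0) ^ (15 * m ^ 2 + 5 * m + 11) + (2 ^ (15 * m ^ 2 + 5 * m + 11)
          + 2 ^ (15 * m ^ 2 + 5 * m + 11)) + 2 ^ (15 * m ^ 2 + 5 * m + 11)) * 2 ^ (m + 1) := by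
          refine mul_le_mul_left ?_ _
          exact (add_le_add h0 (add_le_add h1 h2)).trans le_self_add
      _ = 2 ^ (15 * m ^ 2 + 6 * m + 14) := by ring
      _ ≤ _ := pow_le_pow_right₀ one_le_two (by nlinarith)
  by_cases hD : ¬ I.Synchronous ∨ (I.φ ≠ 0 ∧ I.χ = 1)
  · exact rendezvous_of_block₄ hcgkk hτ hD hrun₄
  rw [not_or, not_not] at hD
  rcases h with h | ⟨hχ, hφ⟩ | ⟨hχ, hφ, ht⟩ | ⟨hχ, ht⟩
  · exact absurd hD.1 h
  · exact absurd ⟨hφ, hχ⟩ hD.2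
  · exact rendezvous_of_block₂ hlate hD.1 hφ hχ ht hrun₂
  · exact rendezvous_of_block₁ hD.1 hχ ht hrun₁

end Instance

end PlaneRV
end

theorem theorem3p2 :
    (∃ cgkk : PlaneRV.Program, PlaneRV.IsCGKK cgkk) ∧
    (∃ latecomers : PlaneRV.Program, PlaneRV.IsLatecomers latecomers) ∧
    ∀ cgkk latecomers : PlaneRV.Program,
      PlaneRV.IsCGKK cgkk → PlaneRV.IsLatecomers latecomers →
      ∀ I : PlaneRV.Instance,
        (¬ I.Synchronous ∨
          (I.χ = 1 ∧ I.φ ≠ 0) ∨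
          (I.χ = 1 ∧ I.φ = 0 ∧ dist PlaneRV.Instance.startA I.startB - I.r < I.t) ∨
          (I.χ = -1 ∧ dist I.projA I.projB - I.r < I.t)) →
        I.Rendezvous (PlaneRV.almostUniversalRV cgkk latecomers) := by
  refine ⟨PlaneRV.exists_isCGKK, PlaneRV.exists_isLatecomers, ?_⟩
  intro cgkk latecomers hcgkk hlate I h
  exact PlaneRV.Instance.rendezvous_almostUniversalRV hcgkk hlate h
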